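/- All logarithms are to base $2$. Let $\mathcal A=\mathbb Z/|\mathcal A|\mathbb Z$ be a finite alphabet, $\mathcal S$ a finite set of states, $f\colon\mathcal A\times\mathcal S\to\mathcal S$ a next-state function and $s_0\in\mathcal S$ an initial state. A parameter $\theta\in\Theta$ is a stochastic matrix $(P_\theta(z\mid s))_{s\in\mathcal S,\,z\in\mathcal A}$; it assigns to $\mathbf z\in\mathcal A^n$ the probability $P_\theta(\mathbf z)=\prod_{i=1}^nP_\theta(z_i\mid s_{i-1})$, where $s_i=f(z_i,s_{i-1})$. Assume that the Markov chain induced on $\mathcal S$, with transition probabilities $\sum_{z:\,f(z,s)=s'}P_\theta(z\mid s)$, is irreducible. Then the Rényi entropy rate $H_{1/2}(P_\theta)=\lim_{n\to\infty}\frac2n\log\sum_{\mathbf z\in\mathcal A^n}P_\theta(\mathbf z)^{1/2}$ exists. Consider the additive channel $\mathbf Y=\mathbf X+\mathbf Z$ with noise $\mathbf Z\sim P_\theta$ on $\mathcal A^n$ independent of the input, and a random code of $M$ independent codewords, each uniform on $\mathcal A^n$, of rate $R=(\log M)/n<\log|\mathcal A|$. Messages are equiprobable. On receiving $\mathbf y$,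 a randomised guessing decoder with guess distribution $\tilde P$ draws independent $\mathbf w_1,\mathbf w_2,\dots\sim\tilde P$ until $\mathbf y-\mathbf w_k$ is a codeword; $Q_{\theta,\tilde P}(n)$ is the expected number of draws, averaged over the message, the random code, the noise and the guesses. The maximising decoder uses $$P_m(\mathbf z)=\frac{\sup_{\theta'\in\Theta}P_{\theta'}(\mathbf z)}{\sum_{\mathbf z'\in\mathcal A^n}\sup_{\theta'\in\Theta}P_{\theta'}(\mathbf z')},$$ and the weighting decoder uses $P_w(\mathbf z)=\int_\Theta P_{\theta'}(\mathbf z)\,d\pi(\theta')$, where under $\pi$ the rows $P_{\theta'}(\cdot\mid s)$, $s\in\mathcal S$, are independent with the Dirichlet$(\tfrac12,\dots,\tfrac12)$ law. Put $$\zeta(n)=|\mathcal A||\mathcal S|\frac{\log(n+1)}n,\qquad \epsilon(n)=\frac{|\mathcal S|(|\mathcal A|-1)}2\,\frac{\log n}n+\frac{2|\mathcal S|}n,$$ $$\sigma_\theta(n)=\frac{2|\mathcal S|}{n}\Bigl(|\mathcal A|\log e+\log|\mathcal A|-\tfrac12|\mathcal A|\log P^*_\theta\Bigr),\qquad P^*_\theta=\min\{P_\theta(z\mid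 s):P_\theta(z\mid s)>0\},$$ $$\lambda_1(n)=\frac2n\log\frac{3}{\frac1n-\frac{2^{nR}}{2|\mathcal A|^n}},\qquad \lambda_2(n)=\frac1n\log\frac n{n-1}.$$ Then, for fixed $R<\log|\mathcal A|$, $\lambda_1(n)=O((\log n)/n)$ and $\lambda_2(n)=O(1/n^2)$, and there is an $n_0$ depending only on $|\mathcal A|$ and $R$ such that, for all $\mathcal S,f,s_0,\theta$ as above and all $n\ge n_0$ for which $M=2^{nR}$ is an integer, $Q_{\theta,P_m}(n)$ and $Q_{\theta,P_w}(n)$ are finite and (a) $\displaystyle\frac1n\log Q_{\theta,P_m}(n)\le\min\Bigl\{H_{1/2}(P_\theta)+2\zeta(n)+\sigma_\theta(n),\ \max\{\lambda_1(n),\ \log|\mathcal A|-R+\lambda_2(n)\}+\zeta(n)+\frac1n\Bigr\};$ (b) $\displaystyle\frac1n\log Q_{\theta,P_w}(n)\le\min\Bigl\{H_{1/2}(P_\theta)+\zeta(n)+\epsilon(n)+\sigma_\theta(n),\ \max\{\lambda_1(n),\ \log|\mathcal A|-R+\lambda_2(n)\}+\epsilon(n)+\frac1n\Bigr\}.$ 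-/

import Mathlib

open scoped ENNReal BigOperators Topology
open MeasureTheory ProbabilityTheory Filter

namespace NoiseGuessing

noncomputable section

/-! ### Finite-state (unifilar) sources

`A` is the finite alphabet, `S` the finite set of states, `f : A → S → S` the next-state function,
`s₀` the initial state. A parameter `θ` is a stochastic matrix, `θ s z` being the probability of the
symbol `z` in the state `s`. Sequences of length `n` are functions `Fin n → A`. -/

/-- The states `s₀, s₁, …, sₙ` visited along `z`, with `sᵢ = f zᵢ sᵢ₋₁`. (Positions of `z` are numbered
from `0`, so `z i` is emitted in the state `stateSeq f s₀ z i.castSucc`.) -/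
def stateSeq {A S : Type*} {n : ℕ} (f : A → S → S) (s₀ : S) (z : Fin n → A) : Fin (n + 1) → S :=
  Fin.induction s₀ (fun i s => f (z i) s)

/-- The parameter set: all stochastic matrices. -/
def paramSet (A S : Type*) [Fintype A] : Set (S → A → ℝ) :=
  {θ | ∀ s, θ s ∈ stdSimplex ℝ A}

/-- The probability of the sequence `z`, starting from the state `s₀`. -/
def seqProb {A S : Type*} {n : ℕ} (f : A → S → S) (s₀ : S) (θ : S → A → ℝ) (z : Fin n → A) : ℝ :=
  ∏ i : Fin n, θ (stateSeq f s₀ z i.castSucc) (z i)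

open scoped Classical in
/-- Transition matrix of the Markov chain induced on the states. -/
def transitionMatrix {A S : Type*} [Fintype A] (f : A → S → S) (θ : S → A → ℝ) : Matrix S S ℝ :=
  fun s s' => ∑ z : A, θ s z * (if f z s = s' then 1 else 0)

/-! ### Rényi entropy and the correction terms; logarithms are to base `2` -/

/-- Rényi entropy of order `α` of a distribution on a finite set. -/
def renyiEntropy {G : Type*} [Fintype G] (α : ℝ) (P : G → ℝ) : ℝ :=
  (1 - α)⁻¹ * Real.logb 2 (∑ z : G, P z ^ α)

/-- The normalised Rényi entropy of the sequences of length `n`. -/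
def normRenyiEntropy {A S : Type*} [Fintype A] (f : A → S → S) (s₀ : S) (θ : S → A → ℝ) (α : ℝ)
    (n : ℕ) : ℝ :=
  renyiEntropy α (fun z : Fin n → A => seqProb f s₀ θ z) / n

/-- The Rényi entropy rate, i.e. the limit of the normalised Rényi entropies (meaningful only if the
limit exists). -/
def renyiEntropyRate {A S : Type*} [Fintype A] (f : A → S → S) (s₀ : S) (θ : S → A → ℝ) (α : ℝ) :
    ℝ :=
  limUnder atTop (normRenyiEntropy f s₀ θ α)

/-- `ζ(n) = |A||S| log(n+1) / n`. -/
def zeta (A S : Type*) [Fintype A] [Fintype S] (n : ℕ) : ℝ :=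
  Fintype.card A * Fintype.card S * (Real.logb 2 (n + 1) / n)

/-- `ε(n) = (|S|(|A|-1)/2) (log n)/n + 2|S|/n`. -/
def epsilon (A S : Type*) [Fintype A] [Fintype S] (n : ℕ) : ℝ :=
  (Fintype.card S : ℝ) * ((Fintype.card A : ℝ) - 1) / 2 * (Real.logb 2 n / n)
    + 2 * Fintype.card S / n

/-- The least positive conditional probability `P*_θ`. -/
def minPosProb {A S : Type*} (θ : S → A → ℝ) : ℝ :=
  sInf {p : ℝ | 0 < p ∧ ∃ s z, θ s z = p}

/-- `σ_θ(n)` for the order `α`. -/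
def sigma {A S : Type*} [Fintype A] [Fintype S] (θ : S → A → ℝ) (α : ℝ) (n : ℕ) : ℝ :=
  (Fintype.card S : ℝ) / (n * (1 - α)) *
    (Fintype.card A * Real.logb 2 (Real.exp 1) + Real.logb 2 (Fintype.card A)
      - α * Fintype.card A * Real.logb 2 (minPosProb θ))

/-- `λ₁(n)` for an alphabet of `q` letters and the rate `R`. -/
def lambda1 (q : ℕ) (R : ℝ) (n : ℕ) : ℝ :=
  2 / n * Real.logb 2 (3 / (1 / n - (2 : ℝ) ^ (n * R) / (2 * (q : ℝ) ^ n)))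

/-- `λ₂(n)`. -/
def lambda2 (n : ℕ) : ℝ :=
  1 / n * Real.logb 2 (n / ((n : ℝ) - 1))

/-! ### Basic facts on sequence probabilities -/

theorem seqProb_nonneg {A S : Type*} [Fintype A] {n : ℕ} (f : A → S → S) (s₀ : S) {θ : S → A → ℝ}
    (hθ : θ ∈ paramSet A S) (z : Fin n → A) : 0 ≤ seqProb f s₀ θ z :=
  Finset.prod_nonneg fun _ _ => (hθ _).1 _

theorem seqProb_le_one {A S : Type*} [Fintype A] {n : ℕ} (f : A → S → S) (s₀ : S) {θ : S → A → ℝ}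
    (hθ : θ ∈ paramSet A S) (z : Fin n → A) : seqProb f s₀ θ z ≤ 1 :=
  Finset.prod_le_one (fun _ _ => (hθ _).1 _) fun i _ =>
    (Finset.single_le_sum (fun a _ => (hθ _).1 a) (Finset.mem_univ (z i))).trans_eq (hθ _).2

theorem stateSeq_cons {A S : Type*} {n : ℕ} (f : A → S → S) (s₀ : S) (a : A) (z : Fin n → A)
    (i : Fin (n + 1)) :
    stateSeq f s₀ (Fin.cons a z : Fin (n + 1) → A) i.succ = stateSeq f (f a s₀) z i := by
  induction i using Fin.induction with
  | zero => rfl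
  | succ i ih =>
    simp only [stateSeq, Fin.induction_succ] at ih ⊢
    rw [← ih, Fin.cons_succ]
    rfl

theorem seqProb_cons {A S : Type*} {n : ℕ} (f : A → S → S) (s₀ : S) (θ : S → A → ℝ) (a : A)
    (z : Fin n → A) :
    seqProb f s₀ θ (Fin.cons a z : Fin (n + 1) → A) = θ s₀ a * seqProb f (f a s₀) θ z := by
  rw [seqProb, Fin.prod_univ_succ]
  congr 1
  refine Finset.prod_congr rfl fun i _ => ?_
  rw [Fin.cons_succ, ← stateSeq_cons]
  rfl

theorem sum_seqProb {A S : Type*} [Fintype A] {n : ℕ} (f : A → S → S) (s₀ : S) {θ : S → A → ℝ}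
    (hθ : θ ∈ paramSet A S) : ∑ z : Fin n → A, seqProb f s₀ θ z = 1 := by
  induction n generalizing s₀ with
  | zero => simp [seqProb]
  | succ n ih =>
    rw [← (Fin.consEquiv fun _ : Fin (n + 1) => A).sum_comp, Fintype.sum_prod_type]
    have h : ∀ a : A, ∀ z : Fin n → A,
        seqProb f s₀ θ ((Fin.consEquiv fun _ : Fin (n + 1) => A) (a, z))
          = θ s₀ a * seqProb f (f a s₀) θ z := fun a z => seqProb_cons f s₀ θ a z
    simp only [h, ← Finset.mul_sum, ih, mul_one]
    exact (hθ s₀).2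

theorem measurable_seqProb {A S : Type*} [Fintype A] {n : ℕ} (f : A → S → S) (s₀ : S)
    (z : Fin n → A) : Measurable fun θ : S → A → ℝ => seqProb f s₀ θ z := by
  unfold seqProb
  fun_prop

/-! ### The maximising distribution -/

/-- The maximal likelihood `sup_θ P_θ(z)`. -/
def maxLikelihood {A S : Type*} [Fintype A] {n : ℕ} (f : A → S → S) (s₀ : S) (z : Fin n → A) :
    ℝ≥0∞ :=
  ⨆ θ ∈ paramSet A S, ENNReal.ofReal (seqProb f s₀ θ z)

theorem maxLikelihood_le_one {A S : Type*} [Fintype A] {n : ℕ} (f : A → S → S) (s₀ : S)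
    (z : Fin n → A) : maxLikelihood f s₀ z ≤ 1 :=
  iSup₂_le fun _ hθ => ENNReal.ofReal_le_one.2 (seqProb_le_one f s₀ hθ z)

theorem maxLikelihood_pos {A S : Type*} [Fintype A] [Nonempty A] {n : ℕ} (f : A → S → S) (s₀ : S)
    (z : Fin n → A) : 0 < maxLikelihood f s₀ z := by
  have hc : (0 : ℝ) < Fintype.card A := by exact_mod_cast Fintype.card_pos
  have hθ : (fun (_ : S) (_ : A) => ((Fintype.card A : ℝ))⁻¹) ∈ paramSet A S := fun _ =>
    ⟨fun _ => by positivity, by simp [hc.ne']⟩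
  refine lt_of_lt_of_le ?_ (le_iSup₂ _ hθ)
  refine ENNReal.ofReal_pos.2 (Finset.prod_pos fun _ _ => ?_)
  positivity

/-- The maximising (normalised maximum likelihood) distribution `P_m`. -/
def maximising {A S : Type*} [Fintype A] [Nonempty A] {n : ℕ} (f : A → S → S) (s₀ : S) :
    PMF (Fin n → A) :=
  PMF.normalize (maxLikelihood f s₀)
    (fun h => (maxLikelihood_pos f s₀ (fun _ : Fin n => Classical.arbitrary A)).ne'
      (ENNReal.tsum_eq_zero.1 h _))
    (by
      rw [tsum_fintype]
      exact ENNReal.sum_ne_top.2 fun z _ =>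
        ((maxLikelihood_le_one f s₀ z).trans_lt ENNReal.one_lt_top).ne)

/-! ### The weighting distribution -/

/-- The Dirichlet law with hyperparameters `α`: the law of `(γ_a / ∑_b γ_b)_a` for independent
`γ_a` with the Gamma law of shape `α a` and rate `1`. -/
def dirichlet {A : Type*} [Fintype A] (α : A → ℝ) : Measure (A → ℝ) :=
  (Measure.pi fun a => gammaMeasure (α a) 1).map fun g a => g a / ∑ b, g b

theorem gammaMeasure_ae_pos {a : ℝ} : ∀ᵐ x ∂gammaMeasure a 1, 0 < x := by
  have hm : Measurable (gammaPDF a 1) := (measurable_gammaPDFReal a 1).ennreal_ofReal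
  rw [gammaMeasure, ae_withDensity_iff hm]
  filter_upwards [compl_mem_ae_iff.2 (measure_singleton (0 : ℝ))] with x hx h
  by_contra hx'
  exact h (gammaPDF_of_neg (lt_of_le_of_ne (not_lt.1 hx') hx))

theorem measurable_dirichlet_map {A : Type*} [Fintype A] :
    Measurable fun (g : A → ℝ) (a : A) => g a / ∑ b, g b := by
  fun_prop

theorem isProbabilityMeasure_dirichlet {A : Type*} [Fintype A] {α : A → ℝ} (hα : ∀ a, 0 < α a) :
    IsProbabilityMeasure (dirichlet α) := by
  have : ∀ a, IsProbabilityMeasure (gammaMeasure (α a) 1) := fun a =>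
    isProbabilityMeasure_gammaMeasure (hα a) one_pos
  exact Measure.isProbabilityMeasure_map measurable_dirichlet_map.aemeasurable

theorem dirichlet_ae_mem_stdSimplex {A : Type*} [Fintype A] [Nonempty A] {α : A → ℝ}
    (hα : ∀ a, 0 < α a) : ∀ᵐ ξ ∂dirichlet α, ξ ∈ stdSimplex ℝ A := by
  have : ∀ a, IsProbabilityMeasure (gammaMeasure (α a) 1) := fun a =>
    isProbabilityMeasure_gammaMeasure (hα a) one_pos
  refine (ae_map_iff measurable_dirichlet_map.aemeasurable
    (isClosed_stdSimplex (𝕜 := ℝ) (ι := A)).measurableSet).2 ?_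
  have h : ∀ᵐ g ∂Measure.pi fun a => gammaMeasure (α a) 1, ∀ a, 0 < g a :=
    ae_all_iff.2 fun a =>
      (Measure.quasiMeasurePreserving_eval (fun a => gammaMeasure (α a) 1) a).ae
        gammaMeasure_ae_pos
  filter_upwards [h] with g hg
  have hs : 0 < ∑ b, g b := Finset.sum_pos (fun b _ => hg b) Finset.univ_nonempty
  exact ⟨fun a => (div_pos (hg a) hs).le, by rw [← Finset.sum_div, div_self hs.ne']⟩

/-- The prior on the parameters: independent Dirichlet laws with hyperparameters `(1/2, …, 1/2)`,
one for each state. -/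
def prior (A S : Type*) [Fintype A] [Fintype S] : Measure (S → A → ℝ) :=
  Measure.pi fun _ : S => dirichlet fun _ : A => 1 / 2

theorem isProbabilityMeasure_prior (A S : Type*) [Fintype A] [Fintype S] :
    IsProbabilityMeasure (prior A S) := by
  have := isProbabilityMeasure_dirichlet (A := A) (α := fun _ => 1 / 2) fun _ => by norm_num
  unfold prior
  infer_instance

theorem prior_ae_mem_paramSet (A S : Type*) [Fintype A] [Nonempty A] [Fintype S] :
    ∀ᵐ θ ∂prior A S, θ ∈ paramSet A S := by
  have := isProbabilityMeasure_dirichlet (A := A) (α := fun _ => 1 / 2) fun _ => by norm_num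
  exact ae_all_iff.2 fun s =>
    (Measure.quasiMeasurePreserving_eval (fun _ : S => dirichlet fun _ : A => 1 / 2) s).ae
      (dirichlet_ae_mem_stdSimplex fun _ => by norm_num)

/-- The weighting distribution `P_w(z) = ∫ P_θ(z) dπ(θ)`, for the prior `π` above
(the Krichevsky–Trofimov distribution). -/
def weighting {A S : Type*} [Fintype A] [Nonempty A] [Fintype S] {n : ℕ} (f : A → S → S)
    (s₀ : S) : PMF (Fin n → A) :=
  PMF.ofFintype (fun z => ∫⁻ θ, ENNReal.ofReal (seqProb f s₀ θ z) ∂prior A S) (by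
    have := isProbabilityMeasure_prior A S
    rw [← lintegral_finsetSum _ fun z _ => (measurable_seqProb f s₀ z).ennreal_ofReal]
    have h : ∀ᵐ θ ∂prior A S,
        ∑ z : Fin n → A, ENNReal.ofReal (seqProb f s₀ θ z) = 1 := by
      filter_upwards [prior_ae_mem_paramSet A S] with θ hθ
      rw [← ENNReal.ofReal_sum_of_nonneg fun z _ => seqProb_nonneg f s₀ hθ z, sum_seqProb f s₀ hθ,
        ENNReal.ofReal_one]
    rw [lintegral_congr_ae h]
    simp)

/-! ### Decoding by randomised guessing -/

/-- The number of guesses `g 0, g 1, …` made until (and including) the first one that lies in `T`;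
it is `∞` if there is none. -/
def numGuesses {G : Type*} (T : Set G) (g : ℕ → G) : ℝ≥0∞ :=
  ⨅ (k : ℕ) (_ : g k ∈ T), ((k : ℝ≥0∞) + 1)

/-- The expected number of guesses when these are drawn independently with law `p`. -/
def meanGuesses {G : Type*} [MeasurableSpace G] (p : PMF G) (T : Set G) : ℝ≥0∞ :=
  ∫⁻ g, numGuesses T g ∂Measure.infinitePi fun _ : ℕ => p.toMeasure

/-- The average number of queries of the randomised guessing decoder with guess distribution `p`:
the average over the message `m` (uniform among `M` messages), over the random code `c` (`M`
independent uniform codewords) and over the noise `z` (with distribution `P`) of the expected number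
of guesses `w` until `y - w` is a codeword, where `y = c m + z` is the received sequence. -/
def averageQueries {A : Type*} [AddCommGroup A] [Fintype A] [MeasurableSpace A] {n : ℕ} (M : ℕ)
    (P : (Fin n → A) → ℝ) (p : PMF (Fin n → A)) : ℝ≥0∞ :=
  ∑ m : Fin M, ∑ c : Fin M → Fin n → A, ∑ z : Fin n → A,
    (M : ℝ≥0∞)⁻¹ * (Fintype.card (Fin M → Fin n → A) : ℝ≥0∞)⁻¹ * ENNReal.ofReal (P z) *
      meanGuesses p {w | c m + z - w ∈ Set.range c}

end

end NoiseGuessing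

open NoiseGuessing Asymptotics

/-! Guesses of law p hit a target set T after at most 1/p(T) draws on average; here T is the
received word minus the codebook. Since T contains the true noise, Q ≤ ∑ P_θ(z)/p(z)
(`averageQueries_le_sum_mul_inv`). Since T has as many elements as there are distinct codewords, Q
is also controlled by the mean inverse size of a random code (`averageQueries_le_of_uniform_le`).
The only property of p needed in both cases is domination: P_θ' ≤ C p for every parameter θ'. For
P_m, C is the number of types (`sum_maxLikelihood_le`). For P_w it is the Krichevsky–Trofimov factor
(4 n^((|A|-1)/2))^|S|. Then (log C)/n is ζ(n) or ε(n).

Rate bound: the uniform law belongs to the class, so p(T) ≥ D/(C|A|^n) with D distinct codewords,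
and the mean of 1/D is at most 2|A|^n/(M(|A|^n - M)) (`sum_inv_card_image_le`). The 2 gives the term
1/n; n M ≤ |A|^n turns the rest into λ₂.

Rényi bound: let L be the operator `sqrtStep`, so that L^n 1 is the sum of the √P_θ(z). For t
slightly above its growth factor there is v > 0 with Lv ≤ t v, and irreducibility bounds the
variation of v by κ = (|A|/√P*)^|S|. Tilting θ by v yields θ' with √P_θ ≤ t^n κ P_θ'. Hence P_θ/p ≤
C P_θ/P_θ' ≤ C t^n κ √P_θ, and summing gives C (t^n κ)². In the limit t^(2n) becomes 2^(nH) with H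
the Rényi rate, and κ² is absorbed by σ.

One factor C suffices in each branch, so the further ζ in the Rényi bounds and the λ₁ in the maximum
are slack. -/

namespace NoiseGuessing

/-! ### Sums of square roots of probabilities as iterates of a positive operator -/

section SqrtSum

variable {A S : Type*} [Fintype A]

/-- The operator `v ↦ (s ↦ ∑ₐ √θ(a | s) v(f(a, s)))` on functions of the state. -/
noncomputable def sqrtStep (f : A → S → S) (θ : S → A → ℝ) (v : S → ℝ) (s : S) : ℝ :=
  ∑ a, √(θ s a) * v (f a s)

/-- The sum of the square roots of the probabilities of the sequences of length `n`. -/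
noncomputable def sqrtSum (f : A → S → S) (θ : S → A → ℝ) (n : ℕ) (s : S) : ℝ :=
  ∑ z : Fin n → A, √(seqProb f s θ z)

variable {f : A → S → S} {θ : S → A → ℝ}

theorem sum_fin_succ_fun {M : Type*} [AddCommMonoid M] {n : ℕ} (g : (Fin (n + 1) → A) → M) :
    ∑ z, g z = ∑ a, ∑ z : Fin n → A, g (Fin.cons a z) := by
  rw [← (Fin.consEquiv fun _ : Fin (n + 1) => A).sum_comp, Fintype.sum_prod_type]
  rfl

@[simp] theorem sqrtSum_zero (s : S) : sqrtSum f θ 0 s = 1 := by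
  simp [sqrtSum, seqProb]

/-- Splitting off the first symbol shows that `sqrtSum f θ n` is the n-th iterate of `sqrtStep`
applied to the constant 1. All growth estimates rest on this. -/
theorem sqrtSum_succ (hθ : θ ∈ paramSet A S) (n : ℕ) :
    sqrtSum f θ (n + 1) = sqrtStep f θ (sqrtSum f θ n) := by
  funext s
  simp only [sqrtSum, sqrtStep, sum_fin_succ_fun, seqProb_cons, Real.sqrt_mul ((hθ _).1 _),
    Finset.mul_sum]

theorem one_le_sqrtSum (hθ : θ ∈ paramSet A S) (n : ℕ) (s : S) : 1 ≤ sqrtSum f θ n s := by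
  rw [← sum_seqProb (n := n) f s hθ]
  refine Finset.sum_le_sum fun z _ => Real.le_sqrt_of_sq_le ?_
  have h0 := seqProb_nonneg f s hθ z
  have h1 := seqProb_le_one f s hθ z
  nlinarith

theorem sqrtSum_pos (hθ : θ ∈ paramSet A S) (n : ℕ) (s : S) : 0 < sqrtSum f θ n s :=
  one_pos.trans_le (one_le_sqrtSum hθ n s)

theorem sqrtStep_mono {v w : S → ℝ} (h : ∀ s, v s ≤ w s) (s : S) :
    sqrtStep f θ v s ≤ sqrtStep f θ w s :=
  Finset.sum_le_sum fun _ _ => mul_le_mul_of_nonneg_left (h _) (Real.sqrt_nonneg _)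

theorem sqrtStep_const_mul (c : ℝ) (v : S → ℝ) (s : S) :
    sqrtStep f θ (fun s => c * v s) s = c * sqrtStep f θ v s := by
  simp only [sqrtStep, Finset.mul_sum]
  exact Finset.sum_congr rfl fun _ _ => by ring

theorem param_le_one (hθ : θ ∈ paramSet A S) (s : S) (a : A) : θ s a ≤ 1 :=
  (Finset.single_le_sum (fun a _ => (hθ s).1 a) (Finset.mem_univ a)).trans_eq (hθ s).2

/-- True for the constant 1 because √θ ≤ 1, and preserved by the monotone operator. It supplies the
hypothesis of `apply_le_pow_mul_of_sqrtStep_le`. -/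
theorem sqrtStep_sqrtSum_le (hθ : θ ∈ paramSet A S) (n : ℕ) (s : S) :
    sqrtStep f θ (sqrtSum f θ n) s ≤ Fintype.card A * sqrtSum f θ n s := by
  induction n generalizing s with
  | zero =>
    simp only [sqrtStep, sqrtSum_zero, mul_one]
    refine (Finset.sum_le_card_nsmul Finset.univ _ 1 fun a _ => ?_).trans_eq (by simp)
    exact Real.sqrt_le_one.2 (param_le_one hθ s a)
  | succ n ih =>
    rw [sqrtSum_succ hθ n]
    exact (sqrtStep_mono ih s).trans_eq (sqrtStep_const_mul _ _ _)

/-- Positivity of L: c ≤ v gives c L^n 1 ≤ L^n v ≤ t^n v. -/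
theorem sqrtSum_mul_le_of_sqrtStep_le (hθ : θ ∈ paramSet A S) {v : S → ℝ} {t c : ℝ} (ht : 0 ≤ t)
    (hv : ∀ s, sqrtStep f θ v s ≤ t * v s) (hc : ∀ s, c ≤ v s) (n : ℕ) (s : S) :
    c * sqrtSum f θ n s ≤ t ^ n * v s := by
  induction n generalizing s with
  | zero => simpa using hc s
  | succ n ih =>
    rw [sqrtSum_succ hθ, ← sqrtStep_const_mul]
    refine (sqrtStep_mono ih s).trans ?_
    rw [sqrtStep_const_mul, pow_succ, mul_assoc]
    exact mul_le_mul_of_nonneg_left (hv s) (by positivity)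

theorem sqrtSum_add_le (hθ : θ ∈ paramSet A S) {n : ℕ} {C : ℝ} (hC : ∀ s, sqrtSum f θ n s ≤ C)
    (m : ℕ) (s : S) : sqrtSum f θ (m + n) s ≤ C * sqrtSum f θ m s := by
  induction m generalizing s with
  | zero => simpa using hC s
  | succ m ih =>
    rw [Nat.add_right_comm, sqrtSum_succ hθ, sqrtSum_succ hθ, ← sqrtStep_const_mul]
    exact sqrtStep_mono ih s

/-- The maximum over the initial state of `sqrtSum`. -/
noncomputable def maxSqrtSum (f : A → S → S) (θ : S → A → ℝ) (n : ℕ) : ℝ :=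
  ⨆ s, sqrtSum f θ n s

theorem sqrtSum_le_max [Finite S] (n : ℕ) (s : S) : sqrtSum f θ n s ≤ maxSqrtSum f θ n :=
  le_ciSup (Set.finite_range _).bddAbove s

theorem one_le_maxSqrtSum [Finite S] [Nonempty S] (hθ : θ ∈ paramSet A S) (n : ℕ) :
    1 ≤ maxSqrtSum f θ n :=
  (one_le_sqrtSum hθ n (Classical.arbitrary S)).trans (sqrtSum_le_max n _)

theorem maxSqrtSum_add_le [Finite S] [Nonempty S] (hθ : θ ∈ paramSet A S) (m n : ℕ) :
    maxSqrtSum f θ (m + n) ≤ maxSqrtSum f θ m * maxSqrtSum f θ n := by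
  refine ciSup_le fun s => (sqrtSum_add_le hθ (sqrtSum_le_max n) m s).trans ?_
  rw [mul_comm]
  exact mul_le_mul_of_nonneg_right (sqrtSum_le_max m s)
    (zero_le_one.trans (one_le_maxSqrtSum hθ n))

theorem maxSqrtSum_le_pow [Finite S] [Nonempty S] (hθ : θ ∈ paramSet A S) (n : ℕ) :
    maxSqrtSum f θ n ≤ (Fintype.card A : ℝ) ^ n := by
  refine ciSup_le fun s => ?_
  have h := sqrtSum_mul_le_of_sqrtStep_le hθ (v := sqrtSum f θ 0) (c := 1) (Nat.cast_nonneg _)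
    (fun s => sqrtStep_sqrtSum_le hθ 0 s) (fun s => by simp) n s
  simpa using h

theorem subadditive_log_maxSqrtSum [Finite S] [Nonempty S] (hθ : θ ∈ paramSet A S) :
    Subadditive fun n => Real.log (maxSqrtSum f θ n) := fun m n => by
  have hm := one_le_maxSqrtSum (f := f) hθ m
  have hn := one_le_maxSqrtSum (f := f) hθ n
  have hmn := one_le_maxSqrtSum (f := f) hθ (m + n)
  rw [← Real.log_mul (by positivity) (by positivity)]
  exact Real.log_le_log (by positivity) (maxSqrtSum_add_le hθ m n)

/-- The exponential growth rate of `maxSqrtSum`. -/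
noncomputable def sqrtSumRate (f : A → S → S) (θ : S → A → ℝ) : ℝ :=
  limUnder atTop fun n : ℕ => Real.log (maxSqrtSum f θ n) / n

theorem tendsto_log_maxSqrtSum [Finite S] [Nonempty S] (hθ : θ ∈ paramSet A S) :
    Tendsto (fun n : ℕ => Real.log (maxSqrtSum f θ n) / n) atTop (𝓝 (sqrtSumRate f θ)) := by
  have h := (subadditive_log_maxSqrtSum (f := f) hθ).tendsto_lim ⟨0, by
    rintro _ ⟨n, rfl⟩
    exact div_nonneg (Real.log_nonneg (one_le_maxSqrtSum hθ n)) (Nat.cast_nonneg n)⟩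
  exact tendsto_nhds_limUnder ⟨_, h⟩

/-- Along the edges of an irreducible chain, a function on the states that grows at most by the
factor `r` on each edge varies at most by the factor `r ^ |S|`. -/
theorem le_pow_card_mul_of_isIrreducible [Fintype S] (hirr : (transitionMatrix f θ).IsIrreducible)
    {v : S → ℝ} {r : ℝ} (hr : 1 ≤ r) (hv0 : ∀ s, 0 ≤ v s)
    (hv : ∀ s a, 0 < θ s a → v (f a s) ≤ r * v s) (s s' : S) :
    v s' ≤ r ^ Fintype.card S * v s := by
  classical
  have hedge : ∀ x y, 0 < transitionMatrix f θ x y → v y ≤ r * v x := by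
    intro x y hxy
    obtain ⟨a, -, ha⟩ := Finset.exists_lt_of_sum_lt (s := Finset.univ) (f := fun _ : A => (0 : ℝ))
      (g := fun z => θ x z * (if f z x = y then 1 else 0)) (by
        simpa [transitionMatrix] using hxy)
    by_cases h : f a x = y
    · simp only [h, if_true, mul_one] at ha
      exact h ▸ hv x a ha
    · simp [h] at ha
  -- A set containing s that no edge leaves contains every endpoint of a path from s, hence is
  -- everything.
  have hexit : ∀ T : Finset S, s ∈ T → T ≠ Finset.univ →
      ∃ x ∈ T, ∃ y ∉ T, 0 < transitionMatrix f θ x y := by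
    intro T hs hT
    by_contra! hcon
    apply hT
    rw [Finset.eq_univ_iff_forall]
    intro y
    let : Quiver S := Matrix.toQuiver (transitionMatrix f θ)
    obtain ⟨p, -⟩ := hirr.connected s y
    clear hT
    induction p with
    | nil => exact hs
    | cons p e ih =>
      by_contra hy
      exact absurd e.down (not_lt.2 (hcon _ ih _ hy))
  -- Each added state costs one factor r, so |S| - 1 additions to {s} exhaust the states.
  have hgrow : ∀ k < Fintype.card S, ∃ T : Finset S, s ∈ T ∧ T.card = k + 1 ∧
      ∀ y ∈ T, v y ≤ r ^ k * v s := by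
    intro k
    induction k with
    | zero => exact fun _ => ⟨{s}, by simp⟩
    | succ k ih =>
      intro hk
      obtain ⟨T, hsT, hcard, hT⟩ := ih (by omega)
      obtain ⟨x, hx, y, hy, hxy⟩ := hexit T hsT (by
        rintro rfl
        rw [Finset.card_univ] at hcard
        omega)
      refine ⟨insert y T, Finset.mem_insert_of_mem hsT, by
        rw [Finset.card_insert_of_notMem hy, hcard], fun w hw => ?_⟩
      have hstep : ∀ w ∈ T, r * v w ≤ r ^ (k + 1) * v s := fun w hw => by
        rw [pow_succ', mul_assoc]
        exact mul_le_mul_of_nonneg_left (hT w hw) (by positivity)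
      rcases Finset.mem_insert.1 hw with rfl | hw
      · exact (hedge x w hxy).trans (hstep x hx)
      · exact (le_mul_of_one_le_left (hv0 w) hr).trans (hstep w hw)
  have hpos : 0 < Fintype.card S := Fintype.card_pos_iff.2 ⟨s⟩
  obtain ⟨T, -, hcard, hT⟩ := hgrow (Fintype.card S - 1) (by omega)
  have hTu : T = Finset.univ := Finset.eq_univ_of_card T (by omega)
  refine (hT s' (hTu ▸ Finset.mem_univ s')).trans
    (mul_le_mul_of_nonneg_right (pow_le_pow_right₀ hr (by omega)) (hv0 s))

end SqrtSum

/-! ### The Rényi rate, tilted parameters and the mean of 1/p -/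

section Rate

variable {A S : Type*} [Fintype A] {f : A → S → S} {θ : S → A → ℝ}

theorem finite_setOf_pos_prob [Finite S] (θ : S → A → ℝ) :
    {p : ℝ | 0 < p ∧ ∃ s z, θ s z = p}.Finite :=
  (Set.finite_range fun x : S × A => θ x.1 x.2).subset fun _ ⟨_, s, z, h⟩ => ⟨(s, z), h⟩

theorem minPosProb_le [Finite S] {s : S} {a : A} (h : 0 < θ s a) : minPosProb θ ≤ θ s a :=
  csInf_le (finite_setOf_pos_prob θ).bddBelow ⟨h, s, a, rfl⟩

theorem exists_param_pos (hθ : θ ∈ paramSet A S) (s : S) : ∃ a, 0 < θ s a := by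
  by_contra! h
  have h1 := (hθ s).2
  have h0 : ∑ a, θ s a ≤ 0 := Finset.sum_nonpos fun a _ => h a
  linarith

theorem minPosProb_pos [Finite S] [Nonempty S] (hθ : θ ∈ paramSet A S) : 0 < minPosProb θ := by
  obtain ⟨a, ha⟩ := exists_param_pos hθ (Classical.arbitrary S)
  have hne : {p : ℝ | 0 < p ∧ ∃ s z, θ s z = p}.Nonempty := ⟨_, ha, _, _, rfl⟩
  exact (hne.csInf_mem (finite_setOf_pos_prob θ)).1

theorem minPosProb_le_one [Finite S] [Nonempty S] (hθ : θ ∈ paramSet A S) :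
    minPosProb θ ≤ 1 := by
  obtain ⟨a, ha⟩ := exists_param_pos hθ (Classical.arbitrary S)
  exact (minPosProb_le ha).trans (param_le_one hθ _ a)

theorem one_le_card_of_paramSet [Nonempty S] (hθ : θ ∈ paramSet A S) :
    (1 : ℝ) ≤ Fintype.card A := by
  obtain ⟨a, -⟩ := exists_param_pos hθ (Classical.arbitrary S)
  exact_mod_cast Fintype.card_pos_iff.2 ⟨a⟩

theorem one_le_card_div_sqrt [Finite S] [Nonempty S] (hθ : θ ∈ paramSet A S) :
    1 ≤ Fintype.card A / √(minPosProb θ) := by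
  rw [one_le_div (Real.sqrt_pos.2 (minPosProb_pos hθ))]
  exact (Real.sqrt_le_one.2 (minPosProb_le_one hθ)).trans (one_le_card_of_paramSet hθ)

/-- An edge of positive probability satisfies √P* v(f(a,s)) ≤ (Lv)(s) ≤ |A| v(s), so v grows by at
most |A|/√P* along it. -/
theorem apply_le_pow_mul_of_sqrtStep_le [Fintype S] (hθ : θ ∈ paramSet A S)
    (hirr : (transitionMatrix f θ).IsIrreducible) {v : S → ℝ} (hv0 : ∀ s, 0 ≤ v s)
    (hv : ∀ s, sqrtStep f θ v s ≤ Fintype.card A * v s) (s s' : S) :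
    v s' ≤ (Fintype.card A / √(minPosProb θ)) ^ Fintype.card S * v s := by
  have : Nonempty S := ⟨s⟩
  refine le_pow_card_mul_of_isIrreducible hirr (one_le_card_div_sqrt hθ) hv0 (fun s a ha => ?_) s s'
  rw [div_mul_eq_mul_div, le_div_iff₀ (Real.sqrt_pos.2 (minPosProb_pos hθ)), mul_comm]
  refine le_trans ?_ (hv s)
  exact (mul_le_mul_of_nonneg_right (Real.sqrt_le_sqrt (minPosProb_le ha)) (hv0 _)).trans
    (Finset.single_le_sum (f := fun a => √(θ s a) * v (f a s))
      (fun a _ => mul_nonneg (Real.sqrt_nonneg _) (hv0 _)) (Finset.mem_univ a))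

/-- The maximum over initial states converges by subadditivity; irreducibility keeps every initial
state within the constant factor κ of it. -/
theorem tendsto_log_sqrtSum [Fintype S] (hθ : θ ∈ paramSet A S)
    (hirr : (transitionMatrix f θ).IsIrreducible) (s : S) :
    Tendsto (fun n : ℕ => Real.log (sqrtSum f θ n s) / n) atTop (𝓝 (sqrtSumRate f θ)) := by
  have : Nonempty S := ⟨s⟩
  set κ : ℝ := (Fintype.card A / √(minPosProb θ)) ^ Fintype.card S with hκ
  have hκ1 : 1 ≤ κ := one_le_pow₀ (one_le_card_div_sqrt hθ)
  have h0 : Tendsto (fun n : ℕ => Real.log (maxSqrtSum f θ n) / n - Real.log κ / n) atTop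
      (𝓝 (sqrtSumRate f θ)) := by
    simpa using (tendsto_log_maxSqrtSum (f := f) hθ).sub
      (tendsto_const_div_atTop_nhds_zero_nat (Real.log κ))
  refine tendsto_of_tendsto_of_tendsto_of_le_of_le h0 (tendsto_log_maxSqrtSum hθ)
    (fun n => ?_) (fun n => ?_)
  · have hmax : maxSqrtSum f θ n ≤ κ * sqrtSum f θ n s := ciSup_le fun s' =>
      apply_le_pow_mul_of_sqrtStep_le hθ hirr (fun s => (sqrtSum_pos hθ n s).le)
        (sqrtStep_sqrtSum_le hθ n) s s'
    have hlog := Real.log_le_log (one_pos.trans_le (one_le_maxSqrtSum hθ n)) hmax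
    rw [Real.log_mul (by positivity) (sqrtSum_pos hθ n s).ne'] at hlog
    rw [← sub_div]
    gcongr
    linarith
  · dsimp only
    gcongr
    exacts [sqrtSum_pos hθ n s, sqrtSum_le_max n s]

theorem normRenyiEntropy_half (s₀ : S) (n : ℕ) :
    normRenyiEntropy f s₀ θ (1 / 2) n
      = 2 / Real.log 2 * (Real.log (sqrtSum f θ n s₀) / n) := by
  simp only [normRenyiEntropy, renyiEntropy, sqrtSum, ← Real.sqrt_eq_rpow, Real.logb]
  ring

theorem tendsto_normRenyiEntropy_half [Fintype S] (hθ : θ ∈ paramSet A S)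
    (hirr : (transitionMatrix f θ).IsIrreducible) (s₀ : S) :
    Tendsto (normRenyiEntropy f s₀ θ (1 / 2)) atTop
      (𝓝 (2 / Real.log 2 * sqrtSumRate f θ)) := by
  rw [funext (normRenyiEntropy_half (f := f) (θ := θ) s₀)]
  exact (tendsto_log_sqrtSum hθ hirr s₀).const_mul _

theorem renyiEntropyRate_half [Fintype S] (hθ : θ ∈ paramSet A S)
    (hirr : (transitionMatrix f θ).IsIrreducible) (s₀ : S) :
    renyiEntropyRate f s₀ θ (1 / 2) = 2 / Real.log 2 * sqrtSumRate f θ :=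
  (tendsto_normRenyiEntropy_half hθ hirr s₀).limUnder_eq

/-- A positive supersolution of the eigenvalue equation of `sqrtStep` yields a tilted parameter. -/
theorem exists_tilted_param [Nonempty A] {v : S → ℝ} {t : ℝ} (ht : 0 < t)
    (hv0 : ∀ s, 0 < v s) (hv : ∀ s, sqrtStep f θ v s ≤ t * v s) :
    ∃ θ' ∈ paramSet A S, ∀ s a, √(θ s a) * v (f a s) ≤ t * v s * θ' s a := by
  have hA : (0 : ℝ) < Fintype.card A := by exact_mod_cast Fintype.card_pos
  have hle : ∀ s, 0 ≤ (1 - sqrtStep f θ v s / (t * v s)) / Fintype.card A := fun s =>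
    div_nonneg (sub_nonneg.2 ((div_le_one (mul_pos ht (hv0 s))).2 (hv s))) hA.le
  -- The weights √θ v(f(a,s))/(t v(s)) sum to at most 1; the missing mass is spread uniformly to
  -- obtain a stochastic row.
  refine ⟨fun s a => √(θ s a) * v (f a s) / (t * v s)
    + (1 - sqrtStep f θ v s / (t * v s)) / Fintype.card A, fun s => ⟨fun a => ?_, ?_⟩,
    fun s a => ?_⟩
  · have := hle s
    have := ht.le
    have := fun s => (hv0 s).le
    have := this s
    have := (hv0 (f a s)).le
    positivity
  · rw [Finset.sum_add_distrib, ← Finset.sum_div]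
    simp only [Finset.sum_const, Finset.card_univ, nsmul_eq_mul, sqrtStep]
    field_simp
    ring
  · have h := mul_pos ht (hv0 s)
    rw [mul_add, mul_div_cancel₀ _ h.ne']
    exact le_add_of_nonneg_right (mul_nonneg h.le (hle s))

/-- Multiplying the one-step inequalities along z telescopes the factors v: only the initial one and
the final one, which is at least c, remain. -/
theorem mul_sqrt_seqProb_le (hθ : θ ∈ paramSet A S) {v : S → ℝ} {t c : ℝ} (ht : 0 ≤ t)
    {θ' : S → A → ℝ} (hθ' : θ' ∈ paramSet A S)
    (h : ∀ s a, √(θ s a) * v (f a s) ≤ t * v s * θ' s a) (hc : ∀ s, c ≤ v s) {n : ℕ} (s : S)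
    (z : Fin n → A) : c * √(seqProb f s θ z) ≤ t ^ n * v s * seqProb f s θ' z := by
  induction n generalizing s with
  | zero => simpa [seqProb] using hc s
  | succ n ih =>
    obtain ⟨a, w, rfl⟩ : ∃ a w, z = Fin.cons a w := ⟨z 0, Fin.tail z, (Fin.cons_self_tail z).symm⟩
    rw [seqProb_cons, seqProb_cons, Real.sqrt_mul ((hθ s).1 a)]
    calc c * (√(θ s a) * √(seqProb f (f a s) θ w))
        = √(θ s a) * (c * √(seqProb f (f a s) θ w)) := by ring
      _ ≤ √(θ s a) * (t ^ n * v (f a s) * seqProb f (f a s) θ' w) :=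
        mul_le_mul_of_nonneg_left (ih _ _) (Real.sqrt_nonneg _)
      _ = t ^ n * seqProb f (f a s) θ' w * (√(θ s a) * v (f a s)) := by ring
      _ ≤ t ^ n * seqProb f (f a s) θ' w * (t * v s * θ' s a) :=
        mul_le_mul_of_nonneg_left (h s a)
          (mul_nonneg (pow_nonneg ht _) (seqProb_nonneg f _ hθ' w))
      _ = _ := by ring

/-- Take v = ∑_{k<m} t^(-k) L^k 1. Applying L/t shifts the sum by one, trading the term 1 for t^(-m)
L^m 1, which is at most 1 by the choice of t. This avoids any eigenvector and works when t is only
the m-th root of the maximum. -/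
theorem exists_supersolution [Fintype S] [Nonempty S] (hθ : θ ∈ paramSet A S) {m : ℕ}
    (hm : 0 < m) {t : ℝ} (ht : 0 < t) (htm : t ^ m = maxSqrtSum f θ m) :
    ∃ v : S → ℝ, (∀ s, 0 < v s) ∧ ∀ s, sqrtStep f θ v s ≤ t * v s := by
  refine ⟨fun s => ∑ k ∈ Finset.range m, (t ^ k)⁻¹ * sqrtSum f θ k s, fun s => ?_, fun s => ?_⟩
  · exact Finset.sum_pos (fun k _ => mul_pos (by positivity) (sqrtSum_pos hθ k s))
      ⟨0, Finset.mem_range.2 hm⟩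
  · have h1 : sqrtStep f θ (fun s => ∑ k ∈ Finset.range m, (t ^ k)⁻¹ * sqrtSum f θ k s) s
        = t * ∑ k ∈ Finset.range m, (t ^ (k + 1))⁻¹ * sqrtSum f θ (k + 1) s := by
      simp only [sqrtSum_succ hθ, sqrtStep, Finset.mul_sum]
      rw [Finset.sum_comm]
      refine Finset.sum_congr rfl fun k _ => Finset.sum_congr rfl fun a _ => ?_
      rw [pow_succ]
      field_simp
    rw [h1]
    refine mul_le_mul_of_nonneg_left ?_ ht.le
    have h2 := Finset.sum_range_succ' (fun k => (t ^ k)⁻¹ * sqrtSum f θ k s) m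
    rw [Finset.sum_range_succ] at h2
    have h3 : (t ^ m)⁻¹ * sqrtSum f θ m s ≤ 1 := by
      rw [inv_mul_le_iff₀ (by positivity), mul_one, htm]
      exact sqrtSum_le_max m s
    simp only [pow_zero, inv_one, sqrtSum_zero, one_mul] at h2
    linarith

theorem sum_seqProb_mul_inv_le_of_pos [Fintype S] (hθ : θ ∈ paramSet A S)
    (hirr : (transitionMatrix f θ).IsIrreducible) {n : ℕ} {s : S} {p : PMF (Fin n → A)} {C : ℝ≥0∞}
    (hp : ∀ θ' ∈ paramSet A S, ∀ z, ENNReal.ofReal (seqProb f s θ' z) ≤ C * p z) {m : ℕ}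
    (hm : 0 < m) :
    ∑ z, ENNReal.ofReal (seqProb f s θ z) * (p z)⁻¹ ≤ C * ENNReal.ofReal
      ((Real.exp (n * (Real.log (maxSqrtSum f θ m) / m))
        * (Fintype.card A / √(minPosProb θ)) ^ Fintype.card S) ^ 2) := by
  have : Nonempty S := ⟨s⟩
  obtain ⟨a₀, -⟩ := exists_param_pos hθ s
  have : Nonempty A := ⟨a₀⟩
  have hA := one_le_card_of_paramSet hθ
  set κ : ℝ := (Fintype.card A / √(minPosProb θ)) ^ Fintype.card S with hκ
  have hκ1 : 1 ≤ κ := one_le_pow₀ (one_le_card_div_sqrt hθ)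
  have hmax := one_le_maxSqrtSum (f := f) hθ m
  have hm' : (0 : ℝ) < m := by exact_mod_cast hm
  set t := Real.exp (Real.log (maxSqrtSum f θ m) / m) with ht
  have ht0 : 0 < t := Real.exp_pos _
  have htm : t ^ m = maxSqrtSum f θ m := by
    rw [ht, ← Real.exp_nat_mul, mul_div_cancel₀ _ hm'.ne', Real.exp_log (by positivity)]
  -- Because t ≤ |A|, also Lv ≤ |A| v, so the variation bound κ does not depend on m.
  have htA : t ≤ Fintype.card A :=
    le_of_pow_le_pow_left₀ hm.ne' (by positivity) (htm.trans_le (maxSqrtSum_le_pow hθ m))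
  obtain ⟨v, hv0, hv⟩ := exists_supersolution hθ hm ht0 htm
  obtain ⟨θ', hθ', hle⟩ := exists_tilted_param ht0 hv0 hv
  have hc : ∀ s', v s / κ ≤ v s' := fun s' => by
    rw [div_le_iff₀' (by positivity)]
    exact apply_le_pow_mul_of_sqrtStep_le hθ hirr (fun s => (hv0 s).le)
      (fun s => (hv s).trans (mul_le_mul_of_nonneg_right htA (hv0 s).le)) s' s
  have hκ0 : 0 < κ := by positivity
  have hvs := hv0 s
  have hz : ∀ z : Fin n → A, √(seqProb f s θ z) ≤ t ^ n * κ * seqProb f s θ' z := fun z => by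
    have h := mul_sqrt_seqProb_le hθ ht0.le hθ' hle hc s z
    rw [div_mul_eq_mul_div, div_le_iff₀ hκ0] at h
    refine le_of_mul_le_mul_left (h.trans_eq ?_) hvs
    ring
  have hsum : sqrtSum f θ n s ≤ t ^ n * κ := by
    have h := sqrtSum_mul_le_of_sqrtStep_le hθ ht0.le hv hc n s
    rw [div_mul_eq_mul_div, div_le_iff₀ hκ0] at h
    refine le_of_mul_le_mul_left (h.trans_eq ?_) hvs
    ring
  have hT : 0 ≤ t ^ n * κ := by positivity
  have hterm : ∀ z, ENNReal.ofReal (seqProb f s θ z) * (p z)⁻¹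
      ≤ C * ENNReal.ofReal (t ^ n * κ * √(seqProb f s θ z)) := fun z => by
    -- Write P_θ = √P_θ · √P_θ and bound one root by the tilted source, which p then dominates.
    have h1 : seqProb f s θ z ≤ t ^ n * κ * √(seqProb f s θ z) * seqProb f s θ' z := by
      nth_rw 1 [← Real.mul_self_sqrt (seqProb_nonneg f s hθ z)]
      nlinarith [hz z, Real.sqrt_nonneg (seqProb f s θ z)]
    calc ENNReal.ofReal (seqProb f s θ z) * (p z)⁻¹
        ≤ ENNReal.ofReal (t ^ n * κ * √(seqProb f s θ z)) * (C * p z) * (p z)⁻¹ := by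
          gcongr
          refine (ENNReal.ofReal_le_ofReal h1).trans ?_
          rw [ENNReal.ofReal_mul (by positivity)]
          gcongr
          exact hp θ' hθ' z
      _ = C * ENNReal.ofReal (t ^ n * κ * √(seqProb f s θ z)) * (p z * (p z)⁻¹) := by ring
      -- The product is at most 1 even for p z = 0, where it is 0 · ∞ = 0.
      _ ≤ _ := mul_le_of_le_one_right' (ENNReal.mul_inv_le_one _)
  refine (Finset.sum_le_sum fun z _ => hterm z).trans ?_
  rw [← Finset.mul_sum, ← ENNReal.ofReal_sum_of_nonneg fun z _ => by positivity, ← Finset.mul_sum,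
    Real.exp_nat_mul, sq]
  gcongr
  exact hsum

/-- If `p` dominates the class of sources up to the factor `C`, then the mean of `1 / p` under the
source `θ` is governed by the Rényi entropy rate of order `1/2`. -/
theorem sum_seqProb_mul_inv_le [Fintype S] (hθ : θ ∈ paramSet A S)
    (hirr : (transitionMatrix f θ).IsIrreducible) {n : ℕ} {s : S} {p : PMF (Fin n → A)} {C : ℝ≥0∞}
    (hC : C ≠ ∞)
    (hp : ∀ θ' ∈ paramSet A S, ∀ z, ENNReal.ofReal (seqProb f s θ' z) ≤ C * p z) :
    ∑ z, ENNReal.ofReal (seqProb f s θ z) * (p z)⁻¹ ≤ C * ENNReal.ofReal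
      ((Real.exp (n * sqrtSumRate f θ)
        * (Fintype.card A / √(minPosProb θ)) ^ Fintype.card S) ^ 2) := by
  have : Nonempty S := ⟨s⟩
  have hlim := tendsto_log_maxSqrtSum (f := f) hθ
  have hlim' := ENNReal.Tendsto.const_mul (a := C) (ENNReal.tendsto_ofReal
    ((((Real.continuous_exp.tendsto _).comp (hlim.const_mul (n : ℝ))).mul_const
      ((Fintype.card A / √(minPosProb θ)) ^ Fintype.card S)).pow 2)) (Or.inr hC)
  -- The left side does not depend on m, so the bounds for all m > 0 pass to the limit; finiteness
  -- of C makes multiplication by it continuous.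
  refine ge_of_tendsto hlim' ?_
  filter_upwards [eventually_gt_atTop 0] with m hm
  exact sum_seqProb_mul_inv_le_of_pos hθ hirr hp hm

theorem sqrtSumRate_nonneg [Fintype S] [Nonempty S] (hθ : θ ∈ paramSet A S) :
    0 ≤ sqrtSumRate f θ :=
  ge_of_tendsto' (tendsto_log_maxSqrtSum hθ) fun n =>
    div_nonneg (Real.log_nonneg (one_le_maxSqrtSum hθ n)) (Nat.cast_nonneg n)

end Rate

/-! ### Mean number of random guesses -/

section Guessing

variable {G : Type*}

/-- The waiting time is the number of k for which the first k guesses all miss. -/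
theorem numGuesses_le_tsum (T : Set G) (g : ℕ → G) :
    numGuesses T g ≤ ∑' k : ℕ, Set.indicator (Set.pi (Finset.range k) fun _ => Tᶜ) 1 g := by
  classical
  by_cases h : ∃ k, g k ∈ T
  · refine (iInf₂_le (Nat.find h) (Nat.find_spec h)).trans ?_
    refine le_trans ?_ (ENNReal.sum_le_tsum (Finset.range (Nat.find h + 1)))
    rw [Finset.sum_congr rfl (g := fun _ => (1 : ℝ≥0∞))]
    · simp
    · intro k hk
      rw [Set.indicator_of_mem]
      · rfl
      · intro j hj
        simp only [Finset.coe_range, Set.mem_Iio, Finset.mem_range] at hj hk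
        exact Nat.find_min h (by omega)
  · push Not at h
    have : ∀ k : ℕ, Set.indicator (Set.pi (Finset.range k) fun _ => Tᶜ) (1 : (ℕ → G) → ℝ≥0∞) g
        = 1 := by
      refine fun k => Set.indicator_of_mem ?_ _
      exact fun j _ => h j
    simp only [this, ENNReal.tsum_const_eq_top_of_ne_zero one_ne_zero, le_top]

/-- By independence the first k guesses all miss with probability p(Tᶜ)^k; the geometric series sums
to 1/p(T), with value ∞ when p(T) = 0. -/
theorem meanGuesses_le [MeasurableSpace G] (p : PMF G) {T : Set G} (hT : MeasurableSet T) :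
    meanGuesses p T ≤ (p.toMeasure T)⁻¹ := by
  have hm : ∀ k : ℕ, MeasurableSet (Set.pi (Finset.range k : Set ℕ) fun _ : ℕ => Tᶜ) := fun k =>
    MeasurableSet.pi (Finset.range k).countable_toSet fun _ _ => hT.compl
  calc meanGuesses p T
      ≤ ∫⁻ g, ∑' k : ℕ, Set.indicator (Set.pi (Finset.range k) fun _ => Tᶜ) 1 g
          ∂Measure.infinitePi fun _ : ℕ => p.toMeasure :=
        lintegral_mono fun g => numGuesses_le_tsum T g
    _ = ∑' k : ℕ, (p.toMeasure Tᶜ) ^ k := by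
        rw [lintegral_tsum fun k => (measurable_one.indicator (hm k)).aemeasurable]
        refine tsum_congr fun k => ?_
        rw [lintegral_indicator_one (hm k), Measure.infinitePi_pi _ fun _ _ => hT.compl]
        simp
    _ = (1 - p.toMeasure Tᶜ)⁻¹ := ENNReal.tsum_geometric _
    _ = (p.toMeasure T)⁻¹ := by
        rw [prob_compl_eq_one_sub hT, ENNReal.sub_sub_cancel ENNReal.one_ne_top prob_le_one]

theorem meanGuesses_le_of_mem [MeasurableSpace G] [DiscreteMeasurableSpace G] (p : PMF G)
    {T : Set G} {z : G} (hz : z ∈ T) : meanGuesses p T ≤ (p z)⁻¹ := by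
  refine (meanGuesses_le p (MeasurableSet.of_discrete)).trans (ENNReal.inv_le_inv.2 ?_)
  rw [← p.toMeasure_apply_singleton z (MeasurableSet.of_discrete)]
  exact measure_mono (Set.singleton_subset_iff.2 hz)

/-- If `p` dominates the uniform distribution up to the factor `C`, then a set of size `D` is hit
within `C |G| / D` guesses on average. -/
theorem meanGuesses_le_of_uniform_le [Fintype G] [MeasurableSpace G] [DiscreteMeasurableSpace G]
    (p : PMF G) {C : ℝ≥0∞} (hp : ∀ z, (Fintype.card G : ℝ≥0∞)⁻¹ ≤ C * p z) {T : Finset G}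
    (hT : T.Nonempty) :
    meanGuesses p T ≤ C * Fintype.card G * (T.card : ℝ≥0∞)⁻¹ := by
  refine (meanGuesses_le p (MeasurableSet.of_discrete)).trans ?_
  rw [PMF.toMeasure_apply_finset]
  have hT0 : (T.card : ℝ≥0∞) ≠ 0 := by exact_mod_cast hT.card_pos.ne'
  have hG : (Fintype.card G : ℝ≥0∞) ≠ 0 := by
    exact_mod_cast (hT.card_pos.trans_le (Finset.card_le_univ T)).ne'
  have h : (T.card : ℝ≥0∞) * (Fintype.card G : ℝ≥0∞)⁻¹ ≤ C * ∑ x ∈ T, p x := by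
    rw [Finset.mul_sum, ← nsmul_eq_mul]
    exact Finset.card_nsmul_le_sum _ _ _ fun z _ => hp z
  have h2 : 1 ≤ C * Fintype.card G * (T.card : ℝ≥0∞)⁻¹ * ∑ x ∈ T, p x :=
    calc (1 : ℝ≥0∞) = (Fintype.card G * (Fintype.card G : ℝ≥0∞)⁻¹)
          * ((T.card : ℝ≥0∞) * (T.card : ℝ≥0∞)⁻¹) := by
          rw [ENNReal.mul_inv_cancel hG (by simp), ENNReal.mul_inv_cancel hT0 (by simp), one_mul]
      _ = Fintype.card G * (T.card : ℝ≥0∞)⁻¹ * (T.card * (Fintype.card G : ℝ≥0∞)⁻¹) := by ring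
      _ ≤ Fintype.card G * (T.card : ℝ≥0∞)⁻¹ * (C * ∑ x ∈ T, p x) := by gcongr
      _ = _ := by ring
  rw [← one_div]
  exact ENNReal.div_le_of_le_mul h2

end Guessing

/-! ### Distinct codewords in a random code -/

section RandomCode

/-- In a random code, with `D` distinct codewords among `M`, the mean of `1 / (D + 1)` is at most
`|V| / ((M + 1) (|V| - M))`. -/
theorem sum_inv_card_image_add_one_le {V : Type*} [Fintype V] [DecidableEq V] {M : ℕ}
    (hM : M < Fintype.card V) :
    ∑ c : Fin M → V, (((Finset.univ.image c).card : ℝ) + 1)⁻¹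
      ≤ (Fintype.card V : ℝ) ^ (M + 1) / ((M + 1) * (Fintype.card V - M)) := by
  set G := Fintype.card V
  have hGM : (0 : ℝ) < G - M := sub_pos.2 (by exact_mod_cast hM)
  rw [le_div_iff₀ (by positivity)]
  -- Double counting over codes with one extra word: an index whose word occurs only once receives
  -- weight 1/D, for D distinct words. There are at most D such indices, so the weights of a code
  -- sum to at most 1.
  let w : (Fin (M + 1) → V) → Fin (M + 1) → ℝ := fun c i =>
    if ∀ j, j ≠ i → c j ≠ c i then ((Finset.univ.image c).card : ℝ)⁻¹ else 0
  have hupper : ∑ c : Fin (M + 1) → V, ∑ i, w c i ≤ (G : ℝ) ^ (M + 1) := by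
    calc ∑ c : Fin (M + 1) → V, ∑ i, w c i ≤ ∑ c : Fin (M + 1) → V, (1 : ℝ) := by
          refine Finset.sum_le_sum fun c _ => ?_
          have hD : 0 < (Finset.univ.image c).card :=
            Finset.card_pos.2 (Finset.univ_nonempty.image c)
          simp only [w, ← Finset.sum_filter, Finset.sum_const, nsmul_eq_mul]
          rw [← div_eq_mul_inv, div_le_one (by exact_mod_cast hD)]
          refine Nat.cast_le.2 (Finset.card_le_card_of_injOn c
            (fun i _ => Finset.mem_image_of_mem c (Finset.mem_univ i)) fun i hi j hj hij => ?_)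
          by_contra hne
          exact (Finset.mem_filter.1 hj).2 i hne hij
      _ = (G : ℝ) ^ (M + 1) := by simp [G]
  -- Delete word i: at least |V| - M values of it avoid the remaining code, and each then has weight
  -- at least 1/(D + 1), where D now counts the remaining distinct words.
  have hlower : ∀ i : Fin (M + 1),
      ∑ c : Fin M → V, (((Finset.univ.image c).card : ℝ) + 1)⁻¹ * (G - M)
        ≤ ∑ c : Fin (M + 1) → V, w c i := by
    intro i
    rw [← (Fin.insertNthEquiv (fun _ : Fin (M + 1) => V) i).sum_comp, Fintype.sum_prod_type,
      Finset.sum_comm]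
    refine Finset.sum_le_sum fun c _ => ?_
    have hout : ((Finset.univ.image c)ᶜ.card : ℝ) = G - (Finset.univ.image c).card := by
      rw [Finset.card_compl, Nat.cast_sub (Finset.card_le_univ _)]
    have hDM : ((Finset.univ.image c).card : ℝ) ≤ M := by
      exact_mod_cast Finset.card_image_le.trans_eq (by simp)
    calc (((Finset.univ.image c).card : ℝ) + 1)⁻¹ * (G - M)
        ≤ (((Finset.univ.image c).card : ℝ) + 1)⁻¹ * ((Finset.univ.image c)ᶜ.card : ℝ) := by
          rw [hout]
          gcongr
      _ = ∑ x ∈ (Finset.univ.image c)ᶜ, (((Finset.univ.image c).card : ℝ) + 1)⁻¹ := by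
          rw [Finset.sum_const, nsmul_eq_mul, mul_comm]
      _ ≤ ∑ x ∈ (Finset.univ.image c)ᶜ,
            w ((Fin.insertNthEquiv (fun _ : Fin (M + 1) => V) i) (x, c)) i := by
          refine Finset.sum_le_sum fun x hx => ?_
          have hx' : ∀ k, c k ≠ x := fun k hk =>
            Finset.mem_compl.1 hx (hk ▸ Finset.mem_image_of_mem c (Finset.mem_univ k))
          have hsing : ∀ j, j ≠ i → (Fin.insertNthEquiv (fun _ : Fin (M + 1) => V) i) (x, c) j
              ≠ (Fin.insertNthEquiv (fun _ : Fin (M + 1) => V) i) (x, c) i := by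
            intro j hj
            obtain ⟨k, rfl⟩ := Fin.exists_succAbove_eq hj
            simpa using hx' k
          simp only [w]
          rw [if_pos hsing]
          have hsub : Finset.univ.image ((Fin.insertNthEquiv (fun _ : Fin (M + 1) => V) i) (x, c))
              ⊆ insert x (Finset.univ.image c) := by
            intro y hy
            obtain ⟨j, -, rfl⟩ := Finset.mem_image.1 hy
            rcases eq_or_ne j i with rfl | hj
            · simp
            · obtain ⟨k, rfl⟩ := Fin.exists_succAbove_eq hj
              simp
          refine inv_anti₀ ?_ ?_
          · exact_mod_cast Finset.card_pos.2 (Finset.univ_nonempty.image _)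
          · exact_mod_cast (Finset.card_le_card hsub).trans (Finset.card_insert_le _ _)
      _ ≤ ∑ x, w ((Fin.insertNthEquiv (fun _ : Fin (M + 1) => V) i) (x, c)) i := by
          refine Finset.sum_le_univ_sum_of_nonneg fun x => ?_
          simp only [w]
          split_ifs <;> positivity
  refine le_trans ?_ hupper
  rw [Finset.sum_comm]
  refine le_trans (le_of_eq ?_) (Finset.sum_le_sum fun i _ => hlower i)
  simp only [Finset.sum_const, Finset.card_univ, Fintype.card_fin, nsmul_eq_mul, ← Finset.sum_mul]
  push_cast
  ring

theorem sum_inv_card_image_le {V : Type*} [Fintype V] [DecidableEq V] {M : ℕ} (hM0 : 0 < M)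
    (hM : M < Fintype.card V) :
    ∑ c : Fin M → V, ((Finset.univ.image c).card : ℝ)⁻¹
      ≤ 2 * (Fintype.card V : ℝ) ^ (M + 1) / (M * (Fintype.card V - M)) := by
  have : Nonempty (Fin M) := ⟨⟨0, hM0⟩⟩
  have hGM : (0 : ℝ) < Fintype.card V - M := sub_pos.2 (by exact_mod_cast hM)
  have hM' : (0 : ℝ) < M := by exact_mod_cast hM0
  calc ∑ c : Fin M → V, ((Finset.univ.image c).card : ℝ)⁻¹
      ≤ ∑ c : Fin M → V, 2 * (((Finset.univ.image c).card : ℝ) + 1)⁻¹ := by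
        refine Finset.sum_le_sum fun c _ => ?_
        have hD : (1 : ℝ) ≤ (Finset.univ.image c).card := by
          exact_mod_cast Finset.card_pos.2 (Finset.univ_nonempty.image c)
        rw [← div_eq_mul_inv, inv_eq_one_div, div_le_div_iff₀ (by positivity) (by positivity)]
        linarith
    _ ≤ 2 * ((Fintype.card V : ℝ) ^ (M + 1) / ((M + 1) * (Fintype.card V - M))) := by
        rw [← Finset.mul_sum]
        gcongr
        exact sum_inv_card_image_add_one_le hM
    _ ≤ _ := by
        rw [mul_div_assoc]
        gcongr
        linarith

end RandomCode

/-! ### The two bounds on the average number of queries -/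

section AverageQueries

theorem sum_codes_const {A : Type*} [Nonempty A] [Fintype A] {n M : ℕ} (hM0 : 0 < M) (x : ℝ≥0∞) :
    ∑ _m : Fin M, ∑ _c : Fin M → Fin n → A,
      (M : ℝ≥0∞)⁻¹ * (Fintype.card (Fin M → Fin n → A) : ℝ≥0∞)⁻¹ * x = x := by
  have hM' : (M : ℝ≥0∞) ≠ 0 := by exact_mod_cast hM0.ne'
  have hc : (Fintype.card (Fin M → Fin n → A) : ℝ≥0∞) ≠ 0 := by exact_mod_cast Fintype.card_ne_zero
  simp only [Finset.sum_const, Finset.card_univ, nsmul_eq_mul]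
  rw [Fintype.card_fin]
  calc _ = ((M : ℝ≥0∞) * (M : ℝ≥0∞)⁻¹) * ((Fintype.card (Fin M → Fin n → A) : ℝ≥0∞)
      * (Fintype.card (Fin M → Fin n → A) : ℝ≥0∞)⁻¹) * x := by ring
    _ = x := by
      rw [ENNReal.mul_inv_cancel hM' (by simp), ENNReal.mul_inv_cancel hc (by simp), one_mul,
        one_mul]

variable {A : Type*} [AddCommGroup A] [Fintype A] [MeasurableSpace A] [DiscreteMeasurableSpace A]
  {n M : ℕ} {P : (Fin n → A) → ℝ} (p : PMF (Fin n → A))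

/-- Guessing the true noise z always succeeds, as c m + z - z = c m. -/
theorem averageQueries_le_sum_mul_inv (hM0 : 0 < M) :
    averageQueries M P p ≤ ∑ z, ENNReal.ofReal (P z) * (p z)⁻¹ := by
  rw [← sum_codes_const (A := A) (n := n) hM0 (∑ z, ENNReal.ofReal (P z) * (p z)⁻¹)]
  refine Finset.sum_le_sum fun m _ => Finset.sum_le_sum fun c _ => ?_
  rw [Finset.mul_sum]
  refine Finset.sum_le_sum fun z _ => ?_
  rw [mul_assoc]
  gcongr
  exact meanGuesses_le_of_mem p (by simp)

/-- The target set is a reflected translate of the codebook, so its size depends neither on the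
message nor on the noise, and only the mean of 1/D over codes matters. -/
theorem averageQueries_le_of_uniform_le (hM0 : 0 < M) (hM : M < Fintype.card (Fin n → A))
    (hP : ∀ z, 0 ≤ P z) (hP1 : ∑ z, P z = 1) {C : ℝ≥0∞}
    (hp : ∀ z, (Fintype.card (Fin n → A) : ℝ≥0∞)⁻¹ ≤ C * p z) :
    averageQueries M P p ≤ C * ENNReal.ofReal (2 * (Fintype.card (Fin n → A) : ℝ) ^ 2
      / (M * (Fintype.card (Fin n → A) - M))) := by
  classical
  set G := Fintype.card (Fin n → A) with hG
  have hG0 : 0 < G := hM0.trans hM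
  have hG0' : (0 : ℝ) < G := by exact_mod_cast hG0
  have : Nonempty (Fin M) := ⟨⟨0, hM0⟩⟩
  have hmean : ∀ (m : Fin M) (c : Fin M → Fin n → A) (z : Fin n → A),
      meanGuesses p {w | c m + z - w ∈ Set.range c}
        ≤ C * G * ENNReal.ofReal (((Finset.univ.image c).card : ℝ)⁻¹) := by
    intro m c z
    have hset : {w | c m + z - w ∈ Set.range c}
        = (((Finset.univ.image c).image fun x => c m + z - x : Finset (Fin n → A)) :
            Set (Fin n → A)) := by
      ext w
      simp only [Set.mem_ofPred_eq, Set.mem_range, Finset.coe_image, Finset.coe_univ,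
        Set.image_univ, Set.mem_image, exists_exists_eq_and]
      exact exists_congr fun k => ⟨fun h => by rw [h]; abel, fun h => by rw [← h]; abel⟩
    have hcard : ((Finset.univ.image c).image fun x => c m + z - x).card
        = (Finset.univ.image c).card :=
      Finset.card_image_of_injective _ sub_right_injective
    have hne : (Finset.univ.image c).Nonempty := Finset.univ_nonempty.image c
    rw [hset, ENNReal.ofReal_inv_of_pos (by exact_mod_cast hne.card_pos), ENNReal.ofReal_natCast,
      ← hcard]
    exact meanGuesses_le_of_uniform_le p hp (hne.image _)
  have hPsum : ∑ z, ENNReal.ofReal (P z) = 1 := by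
    rw [← ENNReal.ofReal_sum_of_nonneg fun z _ => hP z, hP1, ENNReal.ofReal_one]
  have hM' : (M : ℝ≥0∞) ≠ 0 := by exact_mod_cast hM0.ne'
  have hcodes : Fintype.card (Fin M → Fin n → A) = G ^ M := by simp [hG]
  calc averageQueries M P p
      ≤ ∑ m : Fin M, ∑ c : Fin M → Fin n → A, ∑ z : Fin n → A,
          (M : ℝ≥0∞)⁻¹ * ((G : ℝ≥0∞) ^ M)⁻¹ * ENNReal.ofReal (P z)
            * (C * G * ENNReal.ofReal (((Finset.univ.image c).card : ℝ)⁻¹)) := by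
        unfold averageQueries
        rw [hcodes, Nat.cast_pow]
        gcongr
        exact hmean _ _ _
    _ = C * (G * ((G : ℝ≥0∞) ^ M)⁻¹
          * ∑ c : Fin M → Fin n → A, ENNReal.ofReal (((Finset.univ.image c).card : ℝ)⁻¹)) := by
        simp only [← Finset.sum_mul, ← Finset.mul_sum, hPsum, mul_one]
        rw [Finset.sum_const, Finset.card_univ, Fintype.card_fin, nsmul_eq_mul]
        calc _ = (M * (M : ℝ≥0∞)⁻¹) * (C * (G * ((G : ℝ≥0∞) ^ M)⁻¹
          * ∑ c : Fin M → Fin n → A, ENNReal.ofReal (((Finset.univ.image c).card : ℝ)⁻¹))) := by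
              ring
          _ = _ := by rw [ENNReal.mul_inv_cancel hM' (by simp), one_mul]
    _ = C * ENNReal.ofReal (G * ((G : ℝ) ^ M)⁻¹
          * ∑ c : Fin M → Fin n → A, ((Finset.univ.image c).card : ℝ)⁻¹) := by
        rw [ENNReal.ofReal_mul (by positivity), ENNReal.ofReal_mul (by positivity),
          ENNReal.ofReal_inv_of_pos (by positivity), ENNReal.ofReal_pow (by positivity),
          ENNReal.ofReal_natCast, ENNReal.ofReal_sum_of_nonneg fun c _ => by positivity]
    _ ≤ _ := by
        gcongr
        have hGM : (0 : ℝ) < G - M := sub_pos.2 (by exact_mod_cast hM)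
        have hM'' : (0 : ℝ) < M := by exact_mod_cast hM0
        refine (mul_le_mul_of_nonneg_left (sum_inv_card_image_le hM0 hM)
          (by positivity)).trans_eq ?_
        rw [← hG, pow_succ]
        field_simp

end AverageQueries

/-! ### Types and the maximising distribution -/

section Counts

variable {A S : Type*} {n : ℕ} (f : A → S → S) (s₀ : S)

open scoped Classical in
/-- The number of times that the symbol `a` is emitted in the state `s` along the sequence `z`. -/
noncomputable def emissionCount (z : Fin n → A) (s : S) (a : A) : ℕ :=
  (Finset.univ.filter fun i : Fin n => stateSeq f s₀ z i.castSucc = s ∧ z i = a).card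

theorem emissionCount_le (z : Fin n → A) (s : S) (a : A) : emissionCount f s₀ z s a ≤ n :=
  (Finset.card_le_univ _).trans_eq (Fintype.card_fin n)

theorem sum_emissionCount_le [Fintype A] (z : Fin n → A) (s : S) :
    ∑ a, emissionCount f s₀ z s a ≤ n := by
  classical
  have h : ∑ a, emissionCount f s₀ z s a
      = (Finset.univ.filter fun i : Fin n => stateSeq f s₀ z i.castSucc = s).card := by
    rw [Finset.card_eq_sum_card_fiberwise (f := z) (t := Finset.univ) fun _ _ => Finset.mem_univ _]
    refine Finset.sum_congr rfl fun a _ => ?_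
    rw [Finset.filter_filter, emissionCount]
  rw [h]
  exact (Finset.card_le_univ _).trans_eq (Fintype.card_fin n)

theorem seqProb_eq_prod_pow [Fintype A] [Fintype S] (θ : S → A → ℝ) (z : Fin n → A) :
    seqProb f s₀ θ z = ∏ s, ∏ a, θ s a ^ emissionCount f s₀ z s a := by
  classical
  rw [← Fintype.prod_prod_type' fun s a => θ s a ^ emissionCount f s₀ z s a]
  rw [seqProb, ← Finset.prod_fiberwise_of_maps_to
    (g := fun i : Fin n => (stateSeq f s₀ z i.castSucc, z i)) (t := Finset.univ)
    fun _ _ => Finset.mem_univ _]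
  refine Finset.prod_congr rfl fun x _ => ?_
  rw [Finset.prod_congr rfl (g := fun _ => θ x.1 x.2)]
  · rw [Finset.prod_const, emissionCount]
    congr 2
    ext i
    simp [Prod.ext_iff]
  · intro i hi
    rw [← (Finset.mem_filter.1 hi).2]

/-- The sum of the maximal likelihoods is at most the number of types. -/
theorem sum_maxLikelihood_le [Fintype A] [Fintype S] :
    ∑ z : Fin n → A, maxLikelihood f s₀ z
      ≤ ((n : ℝ≥0∞) + 1) ^ (Fintype.card A * Fintype.card S) := by
  classical
  let type : (Fin n → A) → S → A → Fin (n + 1) := fun z s a =>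
    ⟨emissionCount f s₀ z s a, Nat.lt_succ_of_le (emissionCount_le f s₀ z s a)⟩
  have hprob : ∀ z z' θ, type z = type z' → seqProb f s₀ θ z = seqProb f s₀ θ z' := by
    intro z z' θ h
    rw [seqProb_eq_prod_pow, seqProb_eq_prod_pow]
    refine Finset.prod_congr rfl fun s _ => Finset.prod_congr rfl fun a _ => ?_
    rw [show emissionCount f s₀ z s a = emissionCount f s₀ z' s a from
      congrArg Fin.val (congrFun (congrFun h s) a)]
  -- All P_θ are constant on a type class, so there the sum of the suprema is the supremum of the
  -- class probabilities, at most 1.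
  have hfiber : ∀ N, ∑ z with type z = N, maxLikelihood f s₀ z ≤ 1 := by
    intro N
    rcases (Finset.univ.filter fun z => type z = N).eq_empty_or_nonempty with he | ⟨z₀, hz₀⟩
    · simp [he]
    · have hz : ∀ z ∈ Finset.univ.filter (fun z => type z = N), ∀ θ,
          seqProb f s₀ θ z = seqProb f s₀ θ z₀ := fun z hz θ =>
        hprob z z₀ θ ((Finset.mem_filter.1 hz).2.trans (Finset.mem_filter.1 hz₀).2.symm)
      rw [Finset.sum_congr rfl fun z h =>
        show maxLikelihood f s₀ z = maxLikelihood f s₀ z₀ by simp only [maxLikelihood, hz z h],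
        Finset.sum_const, nsmul_eq_mul, maxLikelihood, ENNReal.mul_iSup]
      refine iSup_le fun θ => ?_
      rw [ENNReal.mul_iSup]
      refine iSup_le fun hθ => ?_
      calc _ = ∑ z with type z = N, ENNReal.ofReal (seqProb f s₀ θ z) := by
            rw [Finset.sum_congr rfl fun z h => by rw [hz z h θ], Finset.sum_const, nsmul_eq_mul]
        _ ≤ ∑ z, ENNReal.ofReal (seqProb f s₀ θ z) :=
            Finset.sum_le_sum_of_subset (Finset.filter_subset _ _)
        _ = 1 := by
            rw [← ENNReal.ofReal_sum_of_nonneg fun z _ => seqProb_nonneg f s₀ hθ z,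
              sum_seqProb f s₀ hθ, ENNReal.ofReal_one]
  rw [← Finset.sum_fiberwise_of_maps_to (g := type) (t := Finset.univ) fun _ _ => Finset.mem_univ _]
  refine (Finset.sum_le_sum fun N _ => hfiber N).trans_eq ?_
  simp [pow_mul]

theorem ofReal_seqProb_le_maximising [Fintype A] [Nonempty A] [Fintype S] {θ : S → A → ℝ}
    (hθ : θ ∈ paramSet A S) (z : Fin n → A) :
    ENNReal.ofReal (seqProb f s₀ θ z)
      ≤ ((n : ℝ≥0∞) + 1) ^ (Fintype.card A * Fintype.card S) * maximising f s₀ z := by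
  have h0 : ∑ z : Fin n → A, maxLikelihood f s₀ z ≠ 0 := fun h =>
    (maxLikelihood_pos f s₀ z).ne' (Finset.sum_eq_zero_iff.1 h z (Finset.mem_univ z))
  have htop : ∑ z : Fin n → A, maxLikelihood f s₀ z ≠ ∞ := ENNReal.sum_ne_top.2 fun z _ =>
    ((maxLikelihood_le_one f s₀ z).trans_lt ENNReal.one_lt_top).ne
  calc ENNReal.ofReal (seqProb f s₀ θ z) ≤ maxLikelihood f s₀ z := le_iSup₂_of_le θ hθ le_rfl
    _ = (∑ z : Fin n → A, maxLikelihood f s₀ z) * maximising f s₀ z := by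
      rw [maximising, PMF.normalize_apply, tsum_fintype, mul_left_comm,
        ENNReal.mul_inv_cancel h0 htop, mul_one]
    _ ≤ _ := by
      gcongr
      exact sum_maxLikelihood_le f s₀

end Counts

/-! ### Rising factorials and the Krichevsky–Trofimov inequality -/

section HalfRising

/-- The rising factorial `x (x + 1) ⋯ (x + n - 1)`. -/
noncomputable def risingProd (x : ℝ) (n : ℕ) : ℝ := ∏ i ∈ Finset.range n, (x + i)

theorem risingProd_succ (x : ℝ) (n : ℕ) : risingProd x (n + 1) = risingProd x n * (x + n) :=
  Finset.prod_range_succ _ _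

theorem risingProd_pos {x : ℝ} (hx : 0 < x) (n : ℕ) : 0 < risingProd x n :=
  Finset.prod_pos fun i _ => by positivity

theorem Gamma_add_natCast {x : ℝ} (hx : 0 < x) (n : ℕ) :
    Real.Gamma (x + n) = risingProd x n * Real.Gamma x := by
  induction n with
  | zero => simp [risingProd]
  | succ n ih =>
    rw [Nat.cast_succ, ← add_assoc, Real.Gamma_add_one (by positivity), ih, risingProd_succ]
    ring

/-- The ratio of consecutive values of `(1/2)(3/2)⋯(k - 1/2) / k ^ k`. -/
noncomputable def halfRatio (k : ℕ) : ℝ := (1 / 2 + k) * (k : ℝ) ^ k / ((k : ℝ) + 1) ^ (k + 1)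

theorem antitoneOn_log_halfRatio : AntitoneOn
    (fun x : ℝ => Real.log (1 / 2 + x) + x * Real.log x - (x + 1) * Real.log (x + 1))
    (Set.Ioi 0) := by
  have hd : ∀ x : ℝ, 0 < x → HasDerivAt
      (fun x : ℝ => Real.log (1 / 2 + x) + x * Real.log x - (x + 1) * Real.log (x + 1))
      (1 / (1 / 2 + x) + (Real.log x + 1) - (Real.log (x + 1) + 1)) x := by
    intro x hx
    have h1 : HasDerivAt (fun x : ℝ => Real.log (1 / 2 + x)) (1 / (1 / 2 + x)) x :=
      ((hasDerivAt_id x).const_add (1 / 2)).log (by simp only [id]; positivity)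
    have h2 : HasDerivAt (fun x : ℝ => (x + 1) * Real.log (x + 1)) (Real.log (x + 1) + 1) x := by
      simpa using (Real.hasDerivAt_mul_log (x := x + 1) (by positivity)).comp_add_const x 1
    exact (h1.add (Real.hasDerivAt_mul_log hx.ne')).sub h2
  refine antitoneOn_of_deriv_nonpos (convex_Ioi 0)
    (fun x hx => (hd x hx).continuousAt.continuousWithinAt)
    (fun x hx => (hd x (interior_subset hx)).differentiableAt.differentiableWithinAt) fun x hx => ?_
  have hx0 : 0 < x := interior_subset hx
  rw [(hd x hx0).deriv]
  -- The sign of the derivative amounts to log(1 + u) ≥ 2u/(u + 2) at u = 1/x.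
  have h := Real.le_log_one_add_of_nonneg (x := 1 / x) (by positivity)
  have h3 : 1 + 1 / x = (x + 1) / x := by field_simp
  have h4 : 2 * (1 / x) / (1 / x + 2) = 1 / (1 / 2 + x) := by
    field_simp
  rw [h3, Real.log_div (by positivity) hx0.ne', h4] at h
  linarith

theorem log_halfRatio {k : ℕ} (hk : 0 < k) : Real.log (halfRatio k)
    = Real.log (1 / 2 + k) + k * Real.log k - (k + 1) * Real.log (k + 1) := by
  have hk' : (0 : ℝ) < k := by exact_mod_cast hk
  rw [halfRatio, Real.log_div (by positivity) (by positivity),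
    Real.log_mul (by positivity) (by positivity), Real.log_pow, Real.log_pow]
  push_cast
  ring

theorem halfRatio_pos (k : ℕ) : 0 < halfRatio k := by
  rcases k.eq_zero_or_pos with rfl | hk
  · norm_num [halfRatio]
  · have hk' : (0 : ℝ) < k := by exact_mod_cast hk
    unfold halfRatio
    positivity

theorem antitone_halfRatio : Antitone halfRatio := by
  refine antitone_nat_of_succ_le fun k => ?_
  rcases k.eq_zero_or_pos with rfl | hk
  · norm_num [halfRatio]
  · rw [← Real.log_le_log_iff (halfRatio_pos _) (halfRatio_pos _), log_halfRatio hk,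
      log_halfRatio k.succ_pos]
    have hk' : (0 : ℝ) < k := by exact_mod_cast hk
    exact antitoneOn_log_halfRatio (Set.mem_Ioi.2 hk') (Set.mem_Ioi.2 (by positivity))
      (by simp)

/-- The ratio of the rising factorial of `1/2` and `n ^ n`. -/
noncomputable def halfQuot (n : ℕ) : ℝ := risingProd (1 / 2) n / (n : ℝ) ^ n

theorem halfQuot_pos (n : ℕ) : 0 < halfQuot n :=
  div_pos (risingProd_pos (by norm_num) n) (by exact_mod_cast Nat.pow_self_pos)

theorem halfQuot_succ (n : ℕ) : halfQuot (n + 1) = halfQuot n * halfRatio n := by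
  have h : (0 : ℝ) < (n : ℝ) ^ n := by exact_mod_cast Nat.pow_self_pos
  rw [halfQuot, halfQuot, halfRatio, risingProd_succ]
  push_cast
  field_simp

/-- Submultiplicativity follows from the consecutive ratios being decreasing. -/
theorem halfQuot_add_le (a b : ℕ) : halfQuot (a + b) ≤ halfQuot a * halfQuot b := by
  induction a with
  | zero => simp [halfQuot, risingProd]
  | succ a ih =>
    rw [Nat.add_right_comm, halfQuot_succ, halfQuot_succ, mul_right_comm]
    exact mul_le_mul ih (antitone_halfRatio (Nat.le_add_right a b)) (halfRatio_pos _).le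
      (mul_pos (halfQuot_pos _) (halfQuot_pos _)).le

theorem halfQuot_sum_le {ι : Type*} (s : Finset ι) (k : ι → ℕ) :
    halfQuot (∑ i ∈ s, k i) ≤ ∏ i ∈ s, halfQuot (k i) := by
  induction s using Finset.cons_induction with
  | empty => simp [halfQuot, risingProd]
  | cons i s hi ih =>
    rw [Finset.sum_cons, Finset.prod_cons]
    exact (halfQuot_add_le _ _).trans (mul_le_mul_of_nonneg_left ih (halfQuot_pos _).le)

variable {A : Type*} [Fintype A]

/-- The likelihood is maximised by the empirical frequencies. -/
theorem prod_pow_mul_pow_sum_le {x : A → ℝ} (hx : x ∈ stdSimplex ℝ A) (k : A → ℕ) :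
    (∏ a, x a ^ k a) * ((∑ a, k a : ℕ) : ℝ) ^ (∑ a, k a) ≤ ∏ a, (k a : ℝ) ^ k a := by
  set N := ∑ a, k a with hN
  rcases N.eq_zero_or_pos with h0 | h0
  · have hk : ∀ a, k a = 0 := fun a => Finset.sum_eq_zero_iff.1 (hN ▸ h0) a (Finset.mem_univ a)
    simp [h0, hk]
  have hN0 : (0 : ℝ) < N := by exact_mod_cast h0
  -- Weighted AM–GM with weights k_a/N at the points x_a N/k_a. Letters with k_a = 0 have weight 0,
  -- so the value of the division is harmless.
  have hamgm := Real.geom_mean_le_arith_mean_weighted Finset.univ (fun a => (k a : ℝ) / N)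
    (fun a => x a * N / k a) (fun a _ => by positivity)
    (by rw [← Finset.sum_div, ← Nat.cast_sum, ← hN, div_self hN0.ne'])
    (fun a _ => by have := hx.1 a; positivity)
  have hle : ∑ a, (k a : ℝ) / N * (x a * N / k a) ≤ 1 := by
    rw [← hx.2]
    refine Finset.sum_le_sum fun a _ => ?_
    rcases (k a).eq_zero_or_pos with h | h
    · simpa [h] using hx.1 a
    · have : (0 : ℝ) < k a := by exact_mod_cast h
      exact le_of_eq (by field_simp)
  have hnn : ∀ a, 0 ≤ x a * N / k a := fun a => by have := hx.1 a; positivity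
  have hpow := pow_le_one₀ (n := N)
    (Finset.prod_nonneg fun a _ => Real.rpow_nonneg (hnn a) _) (hamgm.trans hle)
  rw [← Finset.prod_pow] at hpow
  have hterm : ∀ a, ((x a * N / k a) ^ ((k a : ℝ) / N)) ^ N = (x a * N / k a) ^ k a := fun a => by
    rw [← Real.rpow_mul_natCast (hnn a), div_mul_cancel₀ _ hN0.ne', Real.rpow_natCast]
  simp only [hterm, div_pow, mul_pow, Finset.prod_div_distrib, Finset.prod_mul_distrib] at hpow
  rw [Finset.prod_pow_eq_pow_sum, ← hN, div_le_one] at hpow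
  · exact hpow
  · exact Finset.prod_pos fun a _ => by exact_mod_cast Nat.pow_self_pos

/-- With (1/2)(3/2)⋯(n - 1/2) = `halfQuot n` · n^n, submultiplicativity handles the first factor and
the maximum likelihood bound the powers. -/
theorem prod_pow_mul_risingProd_le {x : A → ℝ} (hx : x ∈ stdSimplex ℝ A) (k : A → ℕ) :
    (∏ a, x a ^ k a) * risingProd (1 / 2) (∑ a, k a) ≤ ∏ a, risingProd (1 / 2) (k a) := by
  have hself : ∀ n : ℕ, risingProd (1 / 2) n = halfQuot n * (n : ℝ) ^ n := fun n => by
    have h : (0 : ℝ) < (n : ℝ) ^ n := by exact_mod_cast Nat.pow_self_pos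
    rw [halfQuot, div_mul_cancel₀ _ h.ne']
  simp only [hself, Finset.prod_mul_distrib]
  calc _ = halfQuot (∑ a, k a) * ((∏ a, x a ^ k a) * ((∑ a, k a : ℕ) : ℝ) ^ (∑ a, k a)) := by ring
    _ ≤ _ := mul_le_mul (halfQuot_sum_le _ _) (prod_pow_mul_pow_sum_le hx k)
      (mul_nonneg (Finset.prod_nonneg fun a _ => pow_nonneg (hx.1 a) _) (by positivity))
      (Finset.prod_nonneg fun a _ => (halfQuot_pos _).le)

/-- The strict inequality leaves room for a limit argument with the constant 4, whose logarithm
produces the 2|S|/n in ε(n). Induction proceeds in steps of two, by Γ(x + 1) = xΓ(x). -/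
theorem quarter_Gamma_half_lt (q : ℕ) (hq : 0 < q) :
    Real.Gamma (1 / 2) / 4 < Real.Gamma (q / 2) := by
  have hhalf : 0 < Real.Gamma (1 / 2) := Real.Gamma_pos_of_pos (by norm_num)
  have hstep : ∀ q : ℕ, 0 < q → Real.Gamma ((q + 2 : ℕ) / 2 : ℝ)
      = q / 2 * Real.Gamma (q / 2) := by
    intro q hq
    have hq' : (0 : ℝ) < q := by exact_mod_cast hq
    rw [← Real.Gamma_add_one (by positivity)]
    congr 1
    push_cast
    ring
  have hlt2 : Real.Gamma (1 / 2) < 2 := by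
    rw [Real.Gamma_one_half_eq, Real.sqrt_lt' two_pos]
    linarith [Real.pi_le_four, Real.pi_lt_d2]
  induction q using Nat.strong_induction_on with
  | _ q ih =>
    match q, hq with
    | 1, _ =>
      norm_num
      norm_num at hhalf
      linarith
    | 2, _ =>
      norm_num at hlt2 ⊢
      linarith
    | 3, _ =>
      rw [hstep 1 one_pos]
      norm_num at hhalf ⊢
      linarith
    | q + 4, _ =>
      rw [show q + 4 = (q + 2) + 2 from rfl, hstep (q + 2) (by omega)]
      refine (ih (q + 2) (by omega) (by omega)).trans_le
        (le_mul_of_one_le_left (Real.Gamma_nonneg_of_nonneg (by positivity)) ?_)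
      push_cast
      linarith [(Nat.cast_nonneg q : (0 : ℝ) ≤ q)]

theorem antitone_risingProd_half_div (q : ℕ) (hq : 0 < q) :
    Antitone fun n => risingProd (1 / 2) n / risingProd (q / 2) n := by
  have hq' : (1 : ℝ) ≤ q := by exact_mod_cast hq
  have hpos := fun n => risingProd_pos (x := (q : ℝ) / 2) (by positivity) n
  have hpos' := fun n => risingProd_pos (x := 1 / 2) (by norm_num) n
  refine antitone_nat_of_succ_le fun n => ?_
  rw [risingProd_succ, risingProd_succ, mul_div_mul_comm]
  refine mul_le_of_le_one_right (div_pos (hpos' n) (hpos n)).le ?_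
  rw [div_le_one (by positivity)]
  linarith

theorem eventually_risingProd_le (q : ℕ) (hq : 0 < q) : ∀ᶠ n : ℕ in atTop, ∀ N ≤ n,
    risingProd (q / 2) N ≤ 4 * (n : ℝ) ^ (((q : ℝ) - 1) / 2) * risingProd (1 / 2) N := by
  have hhalf : 0 < Real.Gamma (1 / 2) := Real.Gamma_pos_of_pos (by norm_num)
  have hq' : (0 : ℝ) < q := by exact_mod_cast hq
  have hpos := fun n => risingProd_pos (x := (q : ℝ) / 2) (by positivity) n
  have hpos' := fun n => risingProd_pos (x := 1 / 2) (by norm_num) n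
  have hlim := (Real.GammaSeq_tendsto_Gamma (q / 2)).div (Real.GammaSeq_tendsto_Gamma (1 / 2))
    hhalf.ne'
  have hgt : (1 : ℝ) / 4 < Real.Gamma (q / 2) / Real.Gamma (1 / 2) := by
    rw [lt_div_iff₀ hhalf]
    linarith [quarter_Gamma_half_lt q hq]
  filter_upwards [hlim.eventually (lt_mem_nhds hgt), eventually_gt_atTop 0] with n hn hn0 N hN
  have hn0' : (0 : ℝ) < n := by exact_mod_cast hn0
  -- The denominator of `GammaSeq x n` is x(x + 1)⋯(x + n), with n + 1 factors.
  have heq : Real.GammaSeq (q / 2) n / Real.GammaSeq (1 / 2) n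
      = (n : ℝ) ^ (((q : ℝ) - 1) / 2)
        * (risingProd (1 / 2) (n + 1) / risingProd (q / 2) (n + 1)) := by
    change _ / risingProd (q / 2) (n + 1) / (_ / risingProd (1 / 2) (n + 1)) = _
    have hsplit : (n : ℝ) ^ ((q : ℝ) / 2)
        = (n : ℝ) ^ (((q : ℝ) - 1) / 2) * (n : ℝ) ^ (1 / 2 : ℝ) := by
      rw [← Real.rpow_add hn0']
      congr 1
      ring
    have h1 := (hpos (n + 1)).ne'
    have h2 := (hpos' (n + 1)).ne'
    have h3 : (n : ℝ) ^ (1 / 2 : ℝ) ≠ 0 := by positivity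
    have h4 : ((n.factorial : ℕ) : ℝ) ≠ 0 := by positivity
    rw [hsplit]
    field_simp
  rw [Pi.div_apply, heq] at hn
  -- The quotient decreases, so the single estimate at n + 1 covers all N ≤ n.
  have hanti : risingProd (1 / 2) (n + 1) / risingProd (q / 2) (n + 1)
      ≤ risingProd (1 / 2) N / risingProd (q / 2) N :=
    antitone_risingProd_half_div q hq (by omega)
  have h5 : 1 / 4 < (n : ℝ) ^ (((q : ℝ) - 1) / 2)
      * (risingProd (1 / 2) N / risingProd (q / 2) N) :=
    hn.trans_le (mul_le_mul_of_nonneg_left hanti (by positivity))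
  rw [← mul_div_assoc, lt_div_iff₀ (hpos N)] at h5
  linarith

end HalfRising

/-! ### Dirichlet moments and the weighting distribution -/

section DirichletMoment

theorem lintegral_pi_prod {ι : Type*} [Fintype ι] {X : ι → Type*} [∀ i, MeasurableSpace (X i)]
    (μ : ∀ i, Measure (X i)) [∀ i, IsProbabilityMeasure (μ i)] {F : ∀ i, X i → ℝ≥0∞}
    (hF : ∀ i, Measurable (F i)) :
    ∫⁻ x, ∏ i, F i (x i) ∂Measure.pi μ = ∏ i, ∫⁻ x, F i x ∂μ i := by
  have h := lintegral_prod_eq_prod_lintegral_of_indepFun (μ := Measure.pi μ) Finset.univ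
    (fun i x => F i (x i)) (iIndepFun_pi fun i => (hF i).aemeasurable)
    fun i => (hF i).comp (measurable_pi_apply i)
  rw [h]
  refine Finset.prod_congr rfl fun i _ => ?_
  exact (measurePreserving_eval μ i).lintegral_comp (hF i)

theorem lintegral_rpow_mul_exp {a r : ℝ} (ha : 0 < a) (hr : 0 < r) :
    ∫⁻ x in Set.Ioi (0 : ℝ), ENNReal.ofReal (x ^ (a - 1) * Real.exp (-(r * x)))
      = ENNReal.ofReal ((1 / r) ^ a * Real.Gamma a) := by
  have h := Real.integral_rpow_mul_exp_neg_mul_Ioi ha hr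
  have hpos : 0 < (1 / r) ^ a * Real.Gamma a := by
    have := Real.Gamma_pos_of_pos ha
    positivity
  -- A non-integrable function would have Bochner integral 0, but the value is positive.
  have hint : Integrable (fun x : ℝ => x ^ (a - 1) * Real.exp (-(r * x)))
      (volume.restrict (Set.Ioi 0)) := by
    by_contra hcon
    rw [integral_undef hcon] at h
    exact hpos.ne h
  rw [← h, ofReal_integral_eq_lintegral_ofReal hint]
  filter_upwards [ae_restrict_mem measurableSet_Ioi] with x hx
  have : (0 : ℝ) < x := hx
  positivity

/-- The Beta integral on the half-line. -/
theorem Gamma_add_mul_lintegral {a b : ℝ} (ha : 0 < a) (hb : 0 < b) :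
    ENNReal.ofReal (Real.Gamma (a + b))
        * ∫⁻ t in Set.Ioi (0 : ℝ), ENNReal.ofReal (t ^ (a - 1) * (1 / (1 + t)) ^ (a + b))
      = ENNReal.ofReal (Real.Gamma a * Real.Gamma b) := by
  have hΓ := Real.Gamma_pos_of_pos (add_pos ha hb)
  have hΓa := Real.Gamma_pos_of_pos ha
  calc _ = ∫⁻ t in Set.Ioi (0 : ℝ), ∫⁻ x in Set.Ioi (0 : ℝ), ENNReal.ofReal
          (t ^ (a - 1) * (x ^ (a + b - 1) * Real.exp (-((1 + t) * x)))) := by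
        rw [← lintegral_const_mul _ (by fun_prop)]
        refine setLIntegral_congr_fun measurableSet_Ioi fun t ht => ?_
        have ht0 : (0 : ℝ) < t := ht
        rw [lintegral_congr fun x => ENNReal.ofReal_mul (by positivity),
          lintegral_const_mul _ (by fun_prop), lintegral_rpow_mul_exp (add_pos ha hb) (by positivity),
          ← ENNReal.ofReal_mul (by positivity), ← ENNReal.ofReal_mul (by positivity)]
        ring_nf
    _ = ∫⁻ x in Set.Ioi (0 : ℝ), ∫⁻ t in Set.Ioi (0 : ℝ), ENNReal.ofReal
          (t ^ (a - 1) * (x ^ (a + b - 1) * Real.exp (-((1 + t) * x)))) := by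
        refine lintegral_lintegral_swap (Measurable.aemeasurable ?_)
        unfold Function.uncurry
        fun_prop
    _ = ∫⁻ x in Set.Ioi (0 : ℝ), ENNReal.ofReal (Real.Gamma a)
          * ENNReal.ofReal (x ^ (b - 1) * Real.exp (-(1 * x))) := by
        refine setLIntegral_congr_fun measurableSet_Ioi fun x hx => ?_
        have hx0 : (0 : ℝ) < x := hx
        have hsplit : ∀ t : ℝ, t ^ (a - 1) * (x ^ (a + b - 1) * Real.exp (-((1 + t) * x)))
            = x ^ (a + b - 1) * Real.exp (-x) * (t ^ (a - 1) * Real.exp (-(x * t))) := by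
          intro t
          rw [show -((1 + t) * x) = -x + -(x * t) by ring, Real.exp_add]
          ring
        simp only [hsplit]
        rw [lintegral_congr fun t => ENNReal.ofReal_mul (by positivity),
          lintegral_const_mul _ (by fun_prop), lintegral_rpow_mul_exp ha hx0,
          ← ENNReal.ofReal_mul (by positivity), ← ENNReal.ofReal_mul (by positivity)]
        congr 1
        rw [one_div, Real.inv_rpow hx0.le, show a + b - 1 = a + (b - 1) by ring,
          Real.rpow_add hx0, one_mul]
        have : x ^ a ≠ 0 := by positivity
        field_simp
    _ = _ := by
        rw [lintegral_const_mul _ (by fun_prop), lintegral_rpow_mul_exp hb one_pos,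
          ← ENNReal.ofReal_mul hΓa.le]
        simp

theorem lintegral_gammaMeasure_half (k : ℕ) {t : ℝ} (ht : 0 < t) :
    ∫⁻ x, ENNReal.ofReal (x ^ k * Real.exp (-(t * x))) ∂gammaMeasure (1 / 2) 1
      = ENNReal.ofReal (risingProd (1 / 2) k * (1 / (1 + t)) ^ (1 / 2 + k : ℝ)) := by
  have hΓ : 0 < Real.Gamma (1 / 2) := Real.Gamma_pos_of_pos (by norm_num)
  have hm : Measurable (gammaPDF (1 / 2) 1) := (measurable_gammaPDFReal _ 1).ennreal_ofReal
  rw [gammaMeasure, lintegral_withDensity_eq_lintegral_mul _ hm (by fun_prop)]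
  have hzero : ∀ x ∉ Set.Ici (0 : ℝ), (gammaPDF (1 / 2) 1 * fun x =>
      ENNReal.ofReal (x ^ k * Real.exp (-(t * x)))) x = 0 := fun x hx => by
    rw [Pi.mul_apply, gammaPDF_of_neg (not_le.1 hx), zero_mul]
  rw [← setLIntegral_eq_of_support_subset (s := Set.Ici 0) fun x hx => by
    by_contra hcon
    exact hx (hzero x hcon), setLIntegral_congr Ioi_ae_eq_Ici.symm]
  calc _ = ∫⁻ x in Set.Ioi (0 : ℝ), ENNReal.ofReal (1 / Real.Gamma (1 / 2))
          * ENNReal.ofReal (x ^ ((1 / 2 + k : ℝ) - 1) * Real.exp (-((1 + t) * x))) := by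
        refine setLIntegral_congr_fun measurableSet_Ioi fun x hx => ?_
        have hx0 : (0 : ℝ) < x := hx
        rw [Pi.mul_apply, gammaPDF_of_nonneg hx0.le, ← ENNReal.ofReal_mul (by positivity),
          ← ENNReal.ofReal_mul (by positivity)]
        congr 1
        rw [show (1 / 2 + k : ℝ) - 1 = (1 / 2 - 1) + k by ring, Real.rpow_add hx0,
          Real.rpow_natCast, Real.one_rpow, show -((1 + t) * x) = -(1 * x) + -(t * x) by ring,
          Real.exp_add]
        ring
    _ = _ := by
        rw [lintegral_const_mul _ (by fun_prop),
          lintegral_rpow_mul_exp (by positivity) (by positivity),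
          ← ENNReal.ofReal_mul (by positivity), Gamma_add_natCast (by norm_num)]
        congr 1
        field_simp

variable {A : Type*} [Fintype A] [Nonempty A]

/-- The moments of the Dirichlet law with hyperparameters `1/2`. -/
theorem lintegral_dirichlet_half (k : A → ℕ) :
    ∫⁻ ξ, ENNReal.ofReal (∏ a, ξ a ^ k a) ∂dirichlet (fun _ : A => 1 / 2)
      = ENNReal.ofReal ((∏ a, risingProd (1 / 2) (k a))
          / risingProd (Fintype.card A / 2) (∑ a, k a)) := by
  have hprob : IsProbabilityMeasure (gammaMeasure (1 / 2) 1) :=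
    isProbabilityMeasure_gammaMeasure (by norm_num) one_pos
  have hdir := isProbabilityMeasure_dirichlet (A := A) (α := fun _ => 1 / 2) fun _ => by norm_num
  set N := ∑ a, k a with hN
  rcases N.eq_zero_or_pos with h0 | h0
  · have hk : ∀ a, k a = 0 := fun a => Finset.sum_eq_zero_iff.1 (hN ▸ h0) a (Finset.mem_univ a)
    simp only [h0, hk, risingProd, pow_zero, Finset.prod_const_one, Finset.range_zero,
      Finset.prod_empty, div_one, ENNReal.ofReal_one, lintegral_one, measure_univ]
  have hN0 : (0 : ℝ) < N := by exact_mod_cast h0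
  have hA : (0 : ℝ) < Fintype.card A := by exact_mod_cast Fintype.card_pos
  have hΓN := Real.Gamma_pos_of_pos hN0
  have hΓA := Real.Gamma_pos_of_pos (half_pos hA)
  have hr : ∀ a, 0 < risingProd (1 / 2) (k a) := fun a => risingProd_pos (by norm_num) _
  have hR := risingProd_pos (half_pos hA) N
  have hrp : 0 < ∏ a, risingProd (1 / 2) (k a) := Finset.prod_pos fun a _ => hr a
  have hpos : ∀ᵐ g ∂Measure.pi fun _ : A => gammaMeasure (1 / 2) 1, ∀ a, 0 < g a :=
    ae_all_iff.2 fun a =>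
      (Measure.quasiMeasurePreserving_eval (fun _ : A => gammaMeasure (1 / 2) 1) a).ae
        gammaMeasure_ae_pos
  -- With s = ∑ g_b, write Γ(N) s^(-N) = ∫ t^(N-1) e^(-st) dt. The normalisation then factors over
  -- the letters, and exchanging the integrals leaves one-dimensional Gamma integrals. This needs N
  -- > 0, hence the separate case above.
  have hmain : ENNReal.ofReal (Real.Gamma N)
      * ∫⁻ ξ, ENNReal.ofReal (∏ a, ξ a ^ k a) ∂dirichlet (fun _ : A => 1 / 2)
      = ENNReal.ofReal (∏ a, risingProd (1 / 2) (k a)) * ∫⁻ t in Set.Ioi (0 : ℝ),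
          ENNReal.ofReal (t ^ ((N : ℝ) - 1) * (1 / (1 + t)) ^ (N + Fintype.card A / 2 : ℝ)) := by
    calc _ = ∫⁻ g, (∫⁻ t in Set.Ioi (0 : ℝ), ENNReal.ofReal (t ^ ((N : ℝ) - 1))
            * ∏ a, ENNReal.ofReal (g a ^ k a * Real.exp (-(t * g a))))
            ∂Measure.pi fun _ : A => gammaMeasure (1 / 2) 1 := by
          rw [dirichlet, lintegral_map (by fun_prop) measurable_dirichlet_map,
            ← lintegral_const_mul _ (by fun_prop)]
          refine lintegral_congr_ae ?_
          filter_upwards [hpos] with g hg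
          have hs : 0 < ∑ b, g b := Finset.sum_pos (fun b _ => hg b) Finset.univ_nonempty
          have hgk : 0 ≤ ∏ a, g a ^ k a := Finset.prod_nonneg fun a _ => pow_nonneg (hg a).le _
          have hinner : ∀ t ∈ Set.Ioi (0 : ℝ), ENNReal.ofReal (t ^ ((N : ℝ) - 1))
              * ∏ a, ENNReal.ofReal (g a ^ k a * Real.exp (-(t * g a)))
              = ENNReal.ofReal (∏ a, g a ^ k a)
                * ENNReal.ofReal (t ^ ((N : ℝ) - 1) * Real.exp (-((∑ b, g b) * t))) := by
            intro t ht
            have ht0 : (0 : ℝ) < t := ht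
            rw [← ENNReal.ofReal_prod_of_nonneg fun a _ => by have := hg a; positivity,
              ← ENNReal.ofReal_mul (by positivity), ← ENNReal.ofReal_mul hgk,
              Finset.prod_mul_distrib, ← Real.exp_sum, Finset.sum_neg_distrib, ← Finset.mul_sum]
            ring_nf
          rw [setLIntegral_congr_fun measurableSet_Ioi hinner, lintegral_const_mul _ (by fun_prop),
            lintegral_rpow_mul_exp hN0 hs, ← ENNReal.ofReal_mul hgk, ← ENNReal.ofReal_mul hΓN.le]
          congr 1
          simp only [div_pow, Finset.prod_div_distrib]
          rw [Finset.prod_pow_eq_pow_sum, ← hN, Real.rpow_natCast, one_div, inv_pow]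
          ring
      _ = ∫⁻ t in Set.Ioi (0 : ℝ), (∫⁻ g, ENNReal.ofReal (t ^ ((N : ℝ) - 1))
            * ∏ a, ENNReal.ofReal (g a ^ k a * Real.exp (-(t * g a)))
            ∂Measure.pi fun _ : A => gammaMeasure (1 / 2) 1) := by
          refine lintegral_lintegral_swap (Measurable.aemeasurable ?_)
          unfold Function.uncurry
          fun_prop
      _ = _ := by
          rw [← lintegral_const_mul _ (by fun_prop)]
          refine setLIntegral_congr_fun measurableSet_Ioi fun t ht => ?_
          have ht0 : (0 : ℝ) < t := ht
          rw [lintegral_const_mul _ (by fun_prop), lintegral_pi_prod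
            (F := fun a x => ENNReal.ofReal (x ^ k a * Real.exp (-(t * x)))) _
            (fun a => by fun_prop)]
          simp only [lintegral_gammaMeasure_half _ ht0]
          rw [← ENNReal.ofReal_prod_of_nonneg fun a _ => by have := (hr a).le; positivity,
            ← ENNReal.ofReal_mul (by positivity), ← ENNReal.ofReal_mul hrp.le,
            Finset.prod_mul_distrib, ← Real.rpow_sum_of_pos (by positivity),
            Finset.sum_add_distrib, ← Nat.cast_sum, ← hN, Finset.sum_const, Finset.card_univ,
            nsmul_eq_mul, show (Fintype.card A : ℝ) * (1 / 2) + N = N + Fintype.card A / 2 by ring]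
          ring_nf
  have hbeta := Gamma_add_mul_lintegral hN0 (half_pos hA)
  rw [add_comm (N : ℝ), Gamma_add_natCast (half_pos hA), add_comm _ (N : ℝ)] at hbeta
  have hfin : ENNReal.ofReal (risingProd (Fintype.card A / 2) N * Real.Gamma (Fintype.card A / 2)
        * Real.Gamma N)
      * ∫⁻ ξ, ENNReal.ofReal (∏ a, ξ a ^ k a) ∂dirichlet (fun _ : A => 1 / 2)
      = ENNReal.ofReal ((∏ a, risingProd (1 / 2) (k a))
          * (Real.Gamma N * Real.Gamma (Fintype.card A / 2))) := by
    rw [ENNReal.ofReal_mul (by positivity), mul_assoc, hmain, mul_left_comm, hbeta,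
      ← ENNReal.ofReal_mul hrp.le]
  have hc : 0 < risingProd (Fintype.card A / 2) N * Real.Gamma (Fintype.card A / 2)
      * Real.Gamma N := by positivity
  refine (ENNReal.mul_right_inj (ENNReal.ofReal_pos.2 hc).ne' ENNReal.ofReal_ne_top).1 ?_
  rw [hfin, ← ENNReal.ofReal_mul hc.le]
  congr 1
  field_simp

/-- The Krichevsky–Trofimov bound. -/
theorem eventually_ofReal_seqProb_le_weighting (A : Type*) [Fintype A] [Nonempty A] :
    ∀ᶠ n : ℕ in atTop, ∀ (S : Type) [Fintype S] (f : A → S → S) (s₀ : S),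
      ∀ θ ∈ paramSet A S, ∀ z : Fin n → A, ENNReal.ofReal (seqProb f s₀ θ z)
        ≤ ENNReal.ofReal (4 * (n : ℝ) ^ (((Fintype.card A : ℝ) - 1) / 2)) ^ Fintype.card S
          * weighting f s₀ z := by
  filter_upwards [eventually_risingProd_le (Fintype.card A) Fintype.card_pos] with n hn
  intro S _ f s₀ θ hθ z
  have hdir := isProbabilityMeasure_dirichlet (A := A) (α := fun _ => 1 / 2) fun _ => by norm_num
  have hA : (0 : ℝ) < Fintype.card A := by exact_mod_cast Fintype.card_pos
  set c : ℝ := 4 * (n : ℝ) ^ (((Fintype.card A : ℝ) - 1) / 2) with hc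
  -- The rows are independent under the prior, so P_w is a product over states of Dirichlet moments
  -- of the emission counts.
  have hw : weighting f s₀ z = ∏ s, ENNReal.ofReal
      ((∏ a, risingProd (1 / 2) (emissionCount f s₀ z s a))
          / risingProd (Fintype.card A / 2) (∑ a, emissionCount f s₀ z s a)) := by
    change ∫⁻ θ, ENNReal.ofReal (seqProb f s₀ θ z) ∂prior A S = _
    calc _ = ∫⁻ θ, ∏ s, ENNReal.ofReal (∏ a, θ s a ^ emissionCount f s₀ z s a) ∂prior A S := by
          refine lintegral_congr_ae ?_
          filter_upwards [prior_ae_mem_paramSet A S] with θ hθ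
          rw [seqProb_eq_prod_pow, ENNReal.ofReal_prod_of_nonneg fun s _ =>
            Finset.prod_nonneg fun a _ => pow_nonneg ((hθ s).1 a) _]
      _ = _ := by
          rw [prior, lintegral_pi_prod (fun _ : S => dirichlet fun _ : A => 1 / 2)
            (F := fun s ξ => ENNReal.ofReal (∏ a, ξ a ^ emissionCount f s₀ z s a))
            fun s => by fun_prop]
          simp only [lintegral_dirichlet_half]
  rw [hw, seqProb_eq_prod_pow, ENNReal.ofReal_prod_of_nonneg fun s _ =>
    Finset.prod_nonneg fun a _ => pow_nonneg ((hθ s).1 a) _, ← Finset.card_univ,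
    ← Finset.prod_const, ← Finset.prod_mul_distrib]
  refine Finset.prod_le_prod' fun s _ => ?_
  rw [← ENNReal.ofReal_mul (by positivity)]
  refine ENNReal.ofReal_le_ofReal ?_
  have hR := risingProd_pos (half_pos hA) (∑ a, emissionCount f s₀ z s a)
  have hp : 0 ≤ ∏ a, θ s a ^ emissionCount f s₀ z s a :=
    Finset.prod_nonneg fun a _ => pow_nonneg ((hθ s).1 a) _
  rw [← mul_div_assoc, le_div_iff₀ hR]
  calc _ ≤ (∏ a, θ s a ^ emissionCount f s₀ z s a)
        * (c * risingProd (1 / 2) (∑ a, emissionCount f s₀ z s a)) :=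
        mul_le_mul_of_nonneg_left (hn _ (sum_emissionCount_le f s₀ z s)) hp
    _ = c * ((∏ a, θ s a ^ emissionCount f s₀ z s a)
        * risingProd (1 / 2) (∑ a, emissionCount f s₀ z s a)) := by ring
    _ ≤ _ := mul_le_mul_of_nonneg_left (prod_pow_mul_risingProd_le (hθ s) _) (by positivity)

end DirichletMoment

/-! ### Orders of magnitude of λ₁ and λ₂ -/

section Asymptotic

theorem eventually_natCast_mul_rate_pow_le {q : ℕ} [NeZero q] {R : ℝ} (hR : R < Real.logb 2 q) :
    ∀ᶠ n : ℕ in atTop, (n : ℝ) * (2 : ℝ) ^ (n * R) ≤ (q : ℝ) ^ n := by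
  have hq : (0 : ℝ) < q := by exact_mod_cast NeZero.pos q
  have hlt : (2 : ℝ) ^ R < q := (Real.lt_logb_iff_rpow_lt one_lt_two hq).1 hR
  have hlim := tendsto_self_mul_const_pow_of_lt_one (r := (2 : ℝ) ^ R / q) (by positivity)
    ((div_lt_one hq).2 hlt)
  filter_upwards [hlim.eventually (ge_mem_nhds one_pos)] with n hn
  rw [div_pow, ← mul_div_assoc, div_le_one (by positivity)] at hn
  rwa [mul_comm (n : ℝ) R, Real.rpow_mul_natCast two_pos.le]

theorem isBigO_lambda1 {q : ℕ} [NeZero q] {R : ℝ} (hR : R < Real.logb 2 q) :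
    lambda1 q R =O[atTop] fun n : ℕ => Real.logb 2 n / n := by
  have hq : (0 : ℝ) < q := by exact_mod_cast NeZero.pos q
  refine IsBigO.of_bound 8 ?_
  filter_upwards [eventually_natCast_mul_rate_pow_le hR, eventually_ge_atTop 2] with n hn hn2
  have hn2' : (2 : ℝ) ≤ n := by exact_mod_cast hn2
  have hn0 : (0 : ℝ) < n := by linarith
  have hle : (2 : ℝ) ^ (n * R) / (2 * (q : ℝ) ^ n) ≤ 1 / (2 * n) := by
    rw [div_le_div_iff₀ (by positivity) (by positivity)]
    linarith
  have hnn : 0 ≤ (2 : ℝ) ^ (n * R) / (2 * (q : ℝ) ^ n) := by positivity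
  have hhalf : 1 / (n : ℝ) = 1 / (2 * n) + 1 / (2 * n) := by
    field_simp
    norm_num
  set δ := 1 / (n : ℝ) - (2 : ℝ) ^ (n * R) / (2 * (q : ℝ) ^ n) with hδ
  have hδ1 : 1 / (2 * n) ≤ δ := by linarith
  have hδ0 : 0 < δ := lt_of_lt_of_le (by positivity) hδ1
  have hδ2 : δ ≤ 1 := by
    have : 1 / (n : ℝ) ≤ 1 := by
      rw [div_le_one hn0]
      linarith
    linarith
  have hlow : 0 ≤ Real.logb 2 (3 / δ) := Real.logb_nonneg one_lt_two (by
    rw [le_div_iff₀ hδ0]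
    linarith)
  have hlogn : 1 ≤ Real.logb 2 n := by
    rw [Real.le_logb_iff_rpow_le one_lt_two hn0]
    simpa using hn2'
  have hup : Real.logb 2 (3 / δ) ≤ 4 * Real.logb 2 n := by
    -- From δ ≥ 1/(2n). Then 3 + log n ≤ 4 log n for n ≥ 2, and the prefactor 2/n makes the constant
    -- 8.
    have h1 : 3 / δ ≤ 2 ^ 3 * n := by
      rw [div_le_iff₀ hδ0]
      have h2 : 8 * n * (1 / (2 * n)) ≤ 8 * n * δ :=
        mul_le_mul_of_nonneg_left hδ1 (by positivity)
      have h3 : 8 * (n : ℝ) * (1 / (2 * n)) = 4 := by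
        field_simp
        norm_num
      linarith
    have h2 := Real.logb_le_logb_of_le one_lt_two (by positivity) h1
    rw [Real.logb_mul (by positivity) hn0.ne', Real.logb_pow, Real.logb_self_eq_one one_lt_two]
      at h2
    push_cast at h2
    linarith
  have hl : lambda1 q R n = 2 / n * Real.logb 2 (3 / δ) := rfl
  rw [hl, Real.norm_of_nonneg (by positivity), Real.norm_of_nonneg (by positivity)]
  calc 2 / (n : ℝ) * Real.logb 2 (3 / δ) ≤ 2 / n * (4 * Real.logb 2 n) := by gcongr
    _ = 8 * (Real.logb 2 n / n) := by ring

theorem isBigO_lambda2 : lambda2 =O[atTop] fun n : ℕ => 1 / (n : ℝ) ^ 2 := by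
  refine IsBigO.of_bound 4 ?_
  filter_upwards [eventually_ge_atTop 2] with n hn2
  have hn2' : (2 : ℝ) ≤ n := by exact_mod_cast hn2
  have hn0 : (0 : ℝ) < n := by linarith
  have hn1 : (0 : ℝ) < n - 1 := by linarith
  have hge : 1 ≤ (n : ℝ) / (n - 1) := by
    rw [le_div_iff₀ hn1]
    linarith
  have hlow : 0 ≤ Real.logb 2 (n / ((n : ℝ) - 1)) := Real.logb_nonneg one_lt_two hge
  have hlog2 : 1 / 2 ≤ Real.log 2 := by linarith [Real.log_two_gt_d9]
  have hup : Real.logb 2 (n / ((n : ℝ) - 1)) ≤ 4 / n := by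
    have h1 := Real.log_le_sub_one_of_pos (one_pos.trans_le hge)
    have h2 : (n : ℝ) / (n - 1) - 1 ≤ 2 / n := by
      rw [div_sub_one hn1.ne', div_le_div_iff₀ hn1 hn0]
      linarith
    rw [Real.logb, div_le_iff₀ (by linarith)]
    calc _ ≤ 2 / (n : ℝ) := h1.trans h2
      _ = 4 / n * (1 / 2) := by ring
      _ ≤ 4 / n * Real.log 2 := by gcongr
  rw [lambda2, Real.norm_of_nonneg (by positivity), Real.norm_of_nonneg (by positivity)]
  calc _ ≤ 1 / (n : ℝ) * (4 / n) := by gcongr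
    _ = 4 * (1 / (n : ℝ) ^ 2) := by ring

end Asymptotic

/-! ### From domination to the logarithmic bounds -/

section Bounds

/-- The hypothesis 1 ≤ x covers Q = 0, where the logarithm takes the value 0. -/
theorem logb_toReal_le {Q : ℝ≥0∞} {x : ℝ} (hx : 1 ≤ x) (h : Q ≤ ENNReal.ofReal x) :
    Real.logb 2 Q.toReal ≤ Real.logb 2 x := by
  rcases ENNReal.toReal_nonneg.eq_or_lt (b := Q.toReal) with h0 | h0
  · rw [← h0, Real.logb_zero]
    exact Real.logb_nonneg one_lt_two hx
  · exact Real.logb_le_logb_of_le one_lt_two h0 (ENNReal.toReal_le_of_le_ofReal (by linarith) h)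

variable {S : Type*} {q : ℕ} [NeZero q] {f : ZMod q → S → S} {s₀ : S}
  {θ : S → ZMod q → ℝ}

/-- The left side is (log κ²)/n. In σ there is the further term |A| log e ≥ 0, and -½ log P* ≥ 0
carries the factor |A| instead of 1. -/
theorem two_mul_card_mul_le_sigma [Fintype S] [Nonempty S] (hθ : θ ∈ paramSet (ZMod q) S) (n : ℕ) :
    2 * Fintype.card S / n * (Real.logb 2 q - 1 / 2 * Real.logb 2 (minPosProb θ))
      ≤ sigma θ (1 / 2) n := by
  have hq : (1 : ℝ) ≤ q := by exact_mod_cast NeZero.pos q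
  have hlog : Real.logb 2 (minPosProb θ) ≤ 0 :=
    Real.logb_nonpos one_lt_two (minPosProb_pos hθ).le (minPosProb_le_one hθ)
  have he : 0 ≤ Real.logb 2 (Real.exp 1) :=
    Real.logb_nonneg one_lt_two (Real.one_le_exp zero_le_one)
  have hc : (Fintype.card S : ℝ) / (n * (1 - 1 / 2)) = 2 * Fintype.card S / n := by ring
  rw [sigma, ZMod.card, hc]
  refine mul_le_mul_of_nonneg_left ?_ (by positivity)
  nlinarith [mul_nonneg (sub_nonneg.2 hq) (neg_nonneg.2 hlog),
    mul_nonneg (zero_le_one.trans hq) he]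

theorem logb_queries_le_renyi [Fintype S] (hθ : θ ∈ paramSet (ZMod q) S)
    (hirr : (transitionMatrix f θ).IsIrreducible) {n M : ℕ} (hn : 0 < n) (hM : 0 < M)
    {p : PMF (Fin n → ZMod q)} {c κ : ℝ} (hc : 1 ≤ c) (hlog : Real.logb 2 c = n * κ)
    (hp : ∀ θ' ∈ paramSet (ZMod q) S, ∀ z,
      ENNReal.ofReal (seqProb f s₀ θ' z) ≤ ENNReal.ofReal c * p z) :
    averageQueries M (seqProb f s₀ θ) p ≠ ∞ ∧
      1 / n * Real.logb 2 (averageQueries M (seqProb f s₀ θ) p).toReal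
        ≤ renyiEntropyRate f s₀ θ (1 / 2) + κ + sigma θ (1 / 2) n := by
  have : Nonempty S := ⟨s₀⟩
  have hn' : (0 : ℝ) < n := by exact_mod_cast hn
  have hq : (0 : ℝ) < q := by exact_mod_cast NeZero.pos q
  have hP := minPosProb_pos hθ
  have hK := one_le_card_div_sqrt hθ
  rw [ZMod.card] at hK
  have hle := (averageQueries_le_sum_mul_inv (P := seqProb f s₀ θ) p hM).trans
    (sum_seqProb_mul_inv_le hθ hirr ENNReal.ofReal_ne_top hp)
  rw [← ENNReal.ofReal_mul (by positivity), ZMod.card] at hle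
  refine ⟨(hle.trans_lt ENNReal.ofReal_lt_top).ne, ?_⟩
  have hexp : 1 ≤ Real.exp (n * sqrtSumRate f θ) :=
    Real.one_le_exp (mul_nonneg hn'.le (sqrtSumRate_nonneg hθ))
  have hbase : 1 ≤ Real.exp (n * sqrtSumRate f θ) * (q / √(minPosProb θ)) ^ Fintype.card S :=
    one_le_mul_of_one_le_of_one_le hexp (one_le_pow₀ hK)
  have hlogb := logb_toReal_le (one_le_mul_of_one_le_of_one_le hc (one_le_pow₀ hbase)) hle
  rw [Real.logb_mul (by positivity) (by positivity), hlog, Real.logb_pow,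
    Real.logb_mul (by positivity) (by positivity), Real.logb_pow,
    Real.logb_div (by positivity) (by positivity), Real.sqrt_eq_rpow,
    Real.logb_rpow_eq_mul_logb_of_pos hP,
    show Real.logb 2 (Real.exp (n * sqrtSumRate f θ)) = n * sqrtSumRate f θ / Real.log 2 by
      rw [Real.logb, Real.log_exp]] at hlogb
  rw [renyiEntropyRate_half hθ hirr]
  refine (mul_le_mul_of_nonneg_left hlogb (by positivity)).trans
    (le_trans (le_of_eq ?_) (add_le_add_right (two_mul_card_mul_le_sigma hθ n) _))
  have hlog2 : Real.log 2 ≠ 0 := (Real.log_pos one_lt_two).ne'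
  push_cast
  field_simp
  ring

theorem logb_queries_le_rate (hθ : θ ∈ paramSet (ZMod q) S) {R : ℝ} {n M : ℕ} (hn : 2 ≤ n)
    (hM : 0 < M) (hR : R = Real.logb 2 M / n) (hnR : (n : ℝ) * (2 : ℝ) ^ (n * R) ≤ (q : ℝ) ^ n)
    {p : PMF (Fin n → ZMod q)} {c κ : ℝ} (hc : 1 ≤ c) (hlog : Real.logb 2 c = n * κ)
    (hp : ∀ θ' ∈ paramSet (ZMod q) S, ∀ z,
      ENNReal.ofReal (seqProb f s₀ θ' z) ≤ ENNReal.ofReal c * p z) :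
    1 / n * Real.logb 2 (averageQueries M (seqProb f s₀ θ) p).toReal
      ≤ Real.logb 2 q - R + lambda2 n + κ + 1 / n := by
  have hq : (0 : ℝ) < q := by exact_mod_cast NeZero.pos q
  have hn2 : (2 : ℝ) ≤ n := by exact_mod_cast hn
  have hn0 : (0 : ℝ) < n := by linarith
  have hn1 : (0 : ℝ) < n - 1 := by linarith
  have hM0 : (0 : ℝ) < M := by exact_mod_cast hM
  have hMR : (2 : ℝ) ^ (n * R) = M := by
    rw [hR, mul_div_cancel₀ _ hn0.ne', Real.rpow_logb two_pos (by norm_num) hM0]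
  rw [hMR] at hnR
  have hG0 : (0 : ℝ) < (q : ℝ) ^ n := by positivity
  have hMG : (M : ℝ) < (q : ℝ) ^ n := by nlinarith
  have hcard : (Fintype.card (Fin n → ZMod q) : ℝ) = (q : ℝ) ^ n := by simp [ZMod.card]
  -- The uniform law is the source whose rows are all uniform, so p dominates it too.
  have hunif : ∀ z, (Fintype.card (Fin n → ZMod q) : ℝ≥0∞)⁻¹ ≤ ENNReal.ofReal c * p z := by
    intro z
    refine le_trans (le_of_eq ?_) (hp (fun _ _ => (q : ℝ)⁻¹)
      (fun _ => ⟨fun _ => by positivity, by simp [ZMod.card, hq.ne']⟩) z)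
    rw [seqProb, Finset.prod_const, Finset.card_univ, Fintype.card_fin, inv_pow,
      ENNReal.ofReal_inv_of_pos hG0, ← hcard, ENNReal.ofReal_natCast]
  have hle := averageQueries_le_of_uniform_le (P := seqProb f s₀ θ) p hM
    (by exact_mod_cast hMG.trans_eq hcard.symm) (fun z => seqProb_nonneg f s₀ hθ z)
    (sum_seqProb f s₀ hθ) hunif
  have hx : 2 * (Fintype.card (Fin n → ZMod q) : ℝ) ^ 2 / (M * (Fintype.card (Fin n → ZMod q) - M))
      ≤ 2 * ((q : ℝ) ^ n / M) * (n / (n - 1)) := by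
    have hsub : (0 : ℝ) < (q : ℝ) ^ n - M := sub_pos.2 hMG
    rw [hcard, ← mul_div_assoc 2, div_mul_div_comm, div_le_div_iff₀ (by positivity) (by positivity)]
    -- Equivalent to n M ≤ q^n; this is where n/(n - 1), and so λ₂, comes from.
    have h1 : (q : ℝ) ^ n * (n - 1) ≤ n * ((q : ℝ) ^ n - M) := by nlinarith
    have h2 := mul_le_mul_of_nonneg_left h1 (show 0 ≤ 2 * (q : ℝ) ^ n * M by positivity)
    linarith
  rw [← ENNReal.ofReal_mul (by positivity)] at hle
  have hle' := hle.trans (ENNReal.ofReal_le_ofReal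
    (mul_le_mul_of_nonneg_left hx (zero_le_one.trans hc)))
  have hGM : 1 ≤ (q : ℝ) ^ n / M := (one_le_div hM0).2 hMG.le
  have hnn : 1 ≤ (n : ℝ) / (n - 1) := (one_le_div hn1).2 (by linarith)
  have hone : 1 ≤ c * (2 * ((q : ℝ) ^ n / M) * (n / (n - 1))) :=
    one_le_mul_of_one_le_of_one_le hc (one_le_mul_of_one_le_of_one_le
      (one_le_mul_of_one_le_of_one_le one_le_two hGM) hnn)
  have hlogb := logb_toReal_le hone hle'
  rw [Real.logb_mul (by positivity) (by positivity), hlog,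
    Real.logb_mul (by positivity) (by positivity), Real.logb_mul (by positivity) (by positivity),
    Real.logb_div (by positivity) (by positivity), Real.logb_pow,
    Real.logb_self_eq_one one_lt_two] at hlogb
  refine (mul_le_mul_of_nonneg_left hlogb (by positivity)).trans_eq ?_
  rw [hR, lambda2]
  field_simp
  ring

theorem zeta_nonneg (A S : Type*) [Fintype A] [Fintype S] (n : ℕ) : 0 ≤ zeta A S n := by
  have : 0 ≤ Real.logb 2 ((n : ℝ) + 1) :=
    Real.logb_nonneg one_lt_two (by linarith [(Nat.cast_nonneg n : (0 : ℝ) ≤ n)])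
  unfold zeta
  positivity

theorem queries_bounds [Fintype S] (hθ : θ ∈ paramSet (ZMod q) S)
    (hirr : (transitionMatrix f θ).IsIrreducible) {R : ℝ} {n M : ℕ} (hn : 2 ≤ n)
    (hM : 0 < M) (hR : R = Real.logb 2 M / n) (hnR : (n : ℝ) * (2 : ℝ) ^ (n * R) ≤ (q : ℝ) ^ n)
    {p : PMF (Fin n → ZMod q)} {c κ : ℝ} (hc : 1 ≤ c) (hlog : Real.logb 2 c = n * κ)
    (hp : ∀ θ' ∈ paramSet (ZMod q) S, ∀ z,
      ENNReal.ofReal (seqProb f s₀ θ' z) ≤ ENNReal.ofReal c * p z) :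
    averageQueries M (seqProb f s₀ θ) p ≠ ∞ ∧
      1 / n * Real.logb 2 (averageQueries M (seqProb f s₀ θ) p).toReal
        ≤ min (renyiEntropyRate f s₀ θ (1 / 2) + zeta (ZMod q) S n + κ + sigma θ (1 / 2) n)
          (max (lambda1 q R n) (Real.logb 2 q - R + lambda2 n) + κ + 1 / n) := by
  obtain ⟨hfin, hrenyi⟩ := logb_queries_le_renyi hθ hirr (by omega) hM hc hlog hp
  refine ⟨hfin, le_min ?_ ?_⟩
  · linarith [zeta_nonneg (ZMod q) S n]
  · have hrate := logb_queries_le_rate hθ hn hM hR hnR hc hlog hp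
    linarith [le_max_right (lambda1 q R n) (Real.logb 2 q - R + lambda2 n)]

theorem one_le_maximising_factor (q m n : ℕ) : (1 : ℝ) ≤ ((n : ℝ) + 1) ^ (q * m) :=
  one_le_pow₀ (by linarith [(Nat.cast_nonneg n : (0 : ℝ) ≤ n)])

theorem logb_maximising_factor (A S : Type*) [Fintype A] [Fintype S] {n : ℕ} (hn : 0 < n) :
    Real.logb 2 (((n : ℝ) + 1) ^ (Fintype.card A * Fintype.card S)) = n * zeta A S n := by
  have hn0 : (0 : ℝ) < n := by exact_mod_cast hn
  rw [Real.logb_pow, zeta]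
  push_cast
  field_simp

theorem one_le_weighting_factor {A : Type*} [Fintype A] [Nonempty A] (m : ℕ) {n : ℕ}
    (hn : 0 < n) : (1 : ℝ) ≤ (4 * (n : ℝ) ^ (((Fintype.card A : ℝ) - 1) / 2)) ^ m := by
  have hA : (1 : ℝ) ≤ Fintype.card A := by exact_mod_cast Fintype.card_pos
  exact one_le_pow₀ (one_le_mul_of_one_le_of_one_le (by norm_num)
    (Real.one_le_rpow (by exact_mod_cast hn) (by linarith)))

theorem logb_weighting_factor (A S : Type*) [Fintype A] [Fintype S] {n : ℕ} (hn : 0 < n) :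
    Real.logb 2 ((4 * (n : ℝ) ^ (((Fintype.card A : ℝ) - 1) / 2)) ^ Fintype.card S)
      = n * epsilon A S n := by
  have hn0 : (0 : ℝ) < n := by exact_mod_cast hn
  have h4 : Real.logb 2 4 = 2 := by
    rw [show (4 : ℝ) = 2 ^ 2 by norm_num, Real.logb_pow, Real.logb_self_eq_one one_lt_two]
    norm_num
  rw [Real.logb_pow, Real.logb_mul (by norm_num) (by positivity),
    Real.logb_rpow_eq_mul_logb_of_pos hn0, h4, epsilon]
  field_simp
  ring

end Bounds

end NoiseGuessing

/-! ### The theorem -/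

theorem theorem4 (q : ℕ) [NeZero q] (R : ℝ) (hR : R < Real.logb 2 q) :
    (lambda1 q R =O[atTop] fun n : ℕ => Real.logb 2 n / n) ∧
    (lambda2 =O[atTop] fun n : ℕ => 1 / (n : ℝ) ^ 2) ∧
    ∃ n₀ : ℕ, ∀ (S : Type) [Fintype S] (f : ZMod q → S → S) (s₀ : S) (θ : S → ZMod q → ℝ),
      θ ∈ paramSet (ZMod q) S →
      (transitionMatrix f θ).IsIrreducible →
      Tendsto (normRenyiEntropy f s₀ θ (1 / 2)) atTop (𝓝 (renyiEntropyRate f s₀ θ (1 / 2))) ∧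
      ∀ n : ℕ, n₀ ≤ n → ∀ M : ℕ, 0 < M → R = Real.logb 2 M / n →
        (averageQueries M (seqProb (n := n) f s₀ θ) (maximising f s₀) ≠ ∞ ∧
          1 / n * Real.logb 2
              (averageQueries M (seqProb (n := n) f s₀ θ) (maximising f s₀)).toReal ≤
            min (renyiEntropyRate f s₀ θ (1 / 2) + 2 * zeta (ZMod q) S n + sigma θ (1 / 2) n)
              (max (lambda1 q R n) (Real.logb 2 q - R + lambda2 n)
                + zeta (ZMod q) S n + 1 / n)) ∧
        (averageQueries M (seqProb (n := n) f s₀ θ) (weighting f s₀) ≠ ∞ ∧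
          1 / n * Real.logb 2
              (averageQueries M (seqProb (n := n) f s₀ θ) (weighting f s₀)).toReal ≤
            min (renyiEntropyRate f s₀ θ (1 / 2) + zeta (ZMod q) S n + epsilon (ZMod q) S n
                  + sigma θ (1 / 2) n)
              (max (lambda1 q R n) (Real.logb 2 q - R + lambda2 n)
                + epsilon (ZMod q) S n + 1 / n)) := by
  refine ⟨isBigO_lambda1 hR, isBigO_lambda2, ?_⟩
  -- All three thresholds depend on q and R only; the weighting bound is uniform in the states,
  -- since its threshold comes from rising factorials alone.
  obtain ⟨n₀, hn₀⟩ := eventually_atTop.1 ((eventually_natCast_mul_rate_pow_le hR).and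
    ((eventually_ge_atTop 2).and (eventually_ofReal_seqProb_le_weighting (ZMod q))))
  refine ⟨n₀, fun S _ f s₀ θ hθ hirr => ⟨?_, fun n hn M hM hRM => ?_⟩⟩
  · rw [renyiEntropyRate_half hθ hirr]
    exact tendsto_normRenyiEntropy_half hθ hirr s₀
  · obtain ⟨hnR, hn2, hw⟩ := hn₀ n hn
    refine ⟨?_, ?_⟩
    · have h := queries_bounds hθ hirr hn2 hM hRM hnR
        (one_le_maximising_factor (Fintype.card (ZMod q)) (Fintype.card S) n)
        (logb_maximising_factor (ZMod q) S (by omega)) (p := maximising f s₀) fun θ' hθ' z => by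
          refine (ofReal_seqProb_le_maximising f s₀ hθ' z).trans_eq ?_
          rw [ENNReal.ofReal_pow (by positivity), ENNReal.ofReal_add (by positivity) zero_le_one,
            ENNReal.ofReal_natCast, ENNReal.ofReal_one]
      rwa [add_assoc (renyiEntropyRate f s₀ θ (1 / 2)), ← two_mul] at h
    · refine queries_bounds hθ hirr hn2 hM hRM hnR
        (one_le_weighting_factor (A := ZMod q) (Fintype.card S) (by omega))
        (logb_weighting_factor (ZMod q) S (by omega)) (p := weighting f s₀) fun θ' hθ' z => ?_
      rw [ENNReal.ofReal_pow (by positivity)]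
      exact hw S f s₀ θ' hθ' z
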